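/- Let $E=(E^0,E^1,r,s)$ be an arbitrary directed graph (no restriction on the cardinalities of the sets $E^0$ of vertices and $E^1$ of edges, nor on the number of edges emitted by a vertex) and let $K$ be a field. Let $L=L_K(E)$ be the Leavitt path algebra of $E$ over $K$: the (not necessarily unital) associative $K$-algebra generated by pairwise orthogonal idempotents $v$ ($v\in E^0$) and elements $e,e^*$ ($e\in E^1$) subject to the relations $s(e)e=e=e\,r(e)$ and $r(e)e^*=e^*=e^*s(e)$ for all $e\in E^1$; $e^*e=r(e)$ and $e^*f=0$ for all $e\neq f$ in $E^1$; and $v=\sum_{s(e)=v}ee^*$ for every vertex $v$ that emits a nonempty finite set of edges. Vertices count as paths of length $0$. The algebra $L$ is $\mathbb Z$-graded, its homogeneous component $L_n$ being the $K$-span of the elements $\alpha\beta^*$ with $\alpha,\beta$ paths, $r(\alpha)=r(\beta)$ and $|\alpha|-|\beta|=n$. A graded left $L$-module is a left $L$-module $M$ with $LM=M$, together with a decomposition $M=\bigoplus_{n\in\mathbb Z}M_n$ into additive subgroups such that $L_mM_n\subseteq M_{m+n}$ for all $m,n$. A submodule $N$ is graded if $N=\bigoplus_n(N\cap M_n)$,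 and $M$ is graded-simple if $M\neq 0$ and $0$, $M$ are its only graded submodules. As $L$ need not have an identity, "finitely presented" means finitely presented as a module over the ring $\mathbb Z\oplus L$ obtained from $L$ by adjoining an identity. A minimal graded left ideal of $L$ is a nonzero graded left ideal containing no graded left ideal other than $0$ and itself. The tree of a vertex $v$ is the set $T(v)$ of all vertices $w$ such that there is a path (possibly of length $0$) from $v$ to $w$. A bifurcation is a vertex that emits more than one edge. A cycle is a closed path of positive length that passes through none of its vertices twice; it is without exits if each of its edges is the only edge emitted by the source of that edge. A vertex $v$ is a line point if no vertex of $T(v)$ is a bifurcation or the base of a cycle. A vertex $v$ is a Laurent vertex if $T(v)$ is the set of all vertices on a single path $\mu c$, where $\mu$ is a path (possibly of length $0$) starting at $v$ that contains no bifurcation, and $c$ is a cycle without exits based at the end of $\mu$. Theorem. The following are equivalent: (1) every graded-simple left $L$-module is finitely presented; (2) $L$ is graded semisimple, that is, $L$ is a direct sum of minimal graded left ideals; (3) $E$ is row-finite (no vertex emits infinitely many edges), and for each vertex $u$ there is an integer $n\ge 0$ such that every path that starts at $u$ and has length $\geq n$ ends at a line point or a Laurent vertex. -/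

import Mathlib

universe u v w

/-! ### Directed graphs -/

/-- A directed graph with vertex set `V` and edge set `A` (no restriction on cardinalities). -/
structure DirectedGraph (V : Type u) (A : Type v) where
  /-- the source map -/
  src : A → V
  /-- the range map -/
  tgt : A → V

namespace DirectedGraph

variable {V : Type u} {A : Type v} (E : DirectedGraph V A)

/-- `E.IsPath a p b`: the list of edges `p` is a path from the vertex `a` to the vertex `b`.
The empty list at `a` is the path of length `0` given by the vertex `a`; the length of a path
is the length of its list of edges. -/
inductive IsPath : V → List A → V → Prop
  | nil (a : V) : IsPath a [] a
  | cons (e : A) {p : List A} {b : V} (h : IsPath (E.tgt e) p b) : IsPath (E.src e) (e :: p) b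

/-- The vertices lying on the path `p` starting at `a`. -/
def pathVertices (a : V) (p : List A) : Set V := {x | x = a ∨ ∃ e ∈ p, x = E.tgt e}

/-- The tree of `a`: all the vertices `b` with `a ≥ b`. -/
def tree (a : V) : Set V := {b | ∃ p, E.IsPath a p b}

/-- `a` emits more than one edge. -/
def IsBifurcation (a : V) : Prop := ∃ e f : A, e ≠ f ∧ E.src e = a ∧ E.src f = a

/-- `c` is a cycle based at `a`: a closed path of positive length which does not pass through any
of its vertices twice. -/
def IsCycle (a : V) (c : List A) : Prop :=
  c ≠ [] ∧ E.IsPath a c a ∧ (c.map E.src).Nodup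

/-- The path `c` has no exits. -/
def NoExit (c : List A) : Prop := ∀ e ∈ c, ∀ f, E.src f = E.src e → f = e

/-- `a` is a line point: no vertex of its tree is a bifurcation or the base of a cycle. -/
def IsLinePoint (a : V) : Prop :=
  ∀ b ∈ E.tree a, ¬ E.IsBifurcation b ∧ ¬ ∃ c, E.IsCycle b c

/-- `a` is a Laurent vertex: its tree is the set of vertices of a single path `μ c`, with `μ` a path
without bifurcations starting at `a` and `c` a cycle without exits based at the end of `μ`. -/
def IsLaurentVertex (a : V) : Prop :=
  ∃ (b : V) (μ c : List A), E.IsPath a μ b ∧ (∀ x ∈ E.pathVertices a μ, ¬ E.IsBifurcation x) ∧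
    E.IsCycle b c ∧ E.NoExit c ∧ E.tree a = E.pathVertices a (μ ++ c)

/-- No vertex emits infinitely many edges. -/
def RowFinite : Prop := ∀ a : V, {e | E.src e = a}.Finite

end DirectedGraph

/-! ### The Leavitt path algebra -/

/-- The generators of the Leavitt path algebra: vertices, edges and ghost edges. -/
inductive LPAGenerator (V : Type u) (A : Type v) : Type (max u v)
  | vertex (a : V)
  | edge (e : A)
  | ghost (e : A)

/-- The free (associative, non-unital) `K`-algebra on the generators: the semigroup algebra of the
free semigroup on them. -/
abbrev LPAFree (K : Type w) [Field K] (V : Type u) (A : Type v) : Type (max u v w) :=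
  MonoidAlgebra K (FreeSemigroup (LPAGenerator V A))

/-- A generator as an element of the free algebra. -/
noncomputable def LPAFree.gen (K : Type w) [Field K] {V : Type u} {A : Type v}
    (x : LPAGenerator V A) : LPAFree K V A :=
  MonoidAlgebra.single (FreeSemigroup.of x) 1

section

open LPAGenerator LPAFree

/-- The defining relations of the Leavitt path algebra and their scalar multiples. -/
inductive LPARel (K : Type w) [Field K] {V : Type u} {A : Type v} (E : DirectedGraph V A) :
    LPAFree K V A → LPAFree K V A → Prop
  | vertex_idem (a : V) :
      LPARel K E (gen K (vertex a) * gen K (vertex a)) (gen K (vertex a))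
  | vertex_orth (a b : V) (h : a ≠ b) :
      LPARel K E (gen K (vertex a) * gen K (vertex b)) 0
  | src_edge (e : A) :
      LPARel K E (gen K (vertex (E.src e)) * gen K (edge e)) (gen K (edge e))
  | edge_tgt (e : A) :
      LPARel K E (gen K (edge e) * gen K (vertex (E.tgt e))) (gen K (edge e))
  | tgt_ghost (e : A) :
      LPARel K E (gen K (vertex (E.tgt e)) * gen K (ghost e)) (gen K (ghost e))
  | ghost_src (e : A) :
      LPARel K E (gen K (ghost e) * gen K (vertex (E.src e))) (gen K (ghost e))
  | ck1_same (e : A) :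
      LPARel K E (gen K (ghost e) * gen K (edge e)) (gen K (vertex (E.tgt e)))
  | ck1_ne (e f : A) (h : e ≠ f) :
      LPARel K E (gen K (ghost e) * gen K (edge f)) 0
  | ck2 (a : V) (hfin : {e | E.src e = a}.Finite) (hne : {e | E.src e = a}.Nonempty) :
      LPARel K E (gen K (vertex a)) (∑ e ∈ hfin.toFinset, gen K (edge e) * gen K (ghost e))
  | smul (k : K) {x y : LPAFree K V A} (h : LPARel K E x y) : LPARel K E (k • x) (k • y)

end

/-- The Leavitt path algebra `L_K(E)`: the quotient of the free `K`-algebra on the vertices, edges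
and ghost edges by the ideal generated by the defining relations. It is unital only if `E` has
finitely many vertices. -/
def LeavittPathAlgebra (K : Type w) [Field K] {V : Type u} {A : Type v} (E : DirectedGraph V A) :
    Type (max u v w) :=
  (ringConGen (LPARel K E)).Quotient

namespace LeavittPathAlgebra

variable (K : Type w) [Field K] {V : Type u} {A : Type v} (E : DirectedGraph V A)

noncomputable instance : NonUnitalRing (LeavittPathAlgebra K E) :=
  inferInstanceAs (NonUnitalRing (ringConGen (LPARel K E)).Quotient)

/-- The quotient map from the free algebra. -/
noncomputable def mk : LPAFree K V A →ₙ+* LeavittPathAlgebra K E where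
  toFun x := RingCon.toQuotient x
  map_mul' _ _ := rfl
  map_zero' := rfl
  map_add' _ _ := rfl

theorem mk_surjective : Function.Surjective (mk K E) := Quotient.mk_surjective

theorem smul_rel (k : K) {x y : LPAFree K V A} (h : ringConGen (LPARel K E) x y) :
    ringConGen (LPARel K E) (k • x) (k • y) := by
  have h' : RingConGen.Rel (LPARel K E) x y := h
  change RingConGen.Rel (LPARel K E) (k • x) (k • y)
  clear h
  induction h' with
  | of x y h => exact .of _ _ (.smul k h)
  | refl x => exact .refl _
  | symm _ ih => exact .symm ih
  | trans _ _ ih₁ ih₂ => exact .trans ih₁ ih₂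
  | add _ _ ih₁ ih₂ => simpa only [smul_add] using RingConGen.Rel.add ih₁ ih₂
  | mul _ h₂ ih₁ _ => simpa only [smul_mul_assoc] using RingConGen.Rel.mul ih₁ h₂

noncomputable instance : SMul K (LeavittPathAlgebra K E) where
  smul k := Quotient.map (fun x => k • x) fun _ _ h => smul_rel K E k h

theorem mk_smul (k : K) (x : LPAFree K V A) : mk K E (k • x) = k • mk K E x := rfl

noncomputable instance : Module K (LeavittPathAlgebra K E) :=
  Function.Surjective.module K (mk K E).toAddMonoidHom (mk_surjective K E) (mk_smul K E)

instance : IsScalarTower K (LeavittPathAlgebra K E) (LeavittPathAlgebra K E) where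
  smul_assoc k x y := by
    obtain ⟨x, rfl⟩ := mk_surjective K E x
    obtain ⟨y, rfl⟩ := mk_surjective K E y
    simp only [smul_eq_mul, ← mk_smul, ← map_mul, smul_mul_assoc]

instance : SMulCommClass K (LeavittPathAlgebra K E) (LeavittPathAlgebra K E) where
  smul_comm k x y := by
    obtain ⟨x, rfl⟩ := mk_surjective K E x
    obtain ⟨y, rfl⟩ := mk_surjective K E y
    simp only [smul_eq_mul, ← mk_smul, ← map_mul, mul_smul_comm]

/-- A vertex as an element of `L`. -/
noncomputable def vertex (a : V) : LeavittPathAlgebra K E := mk K E (.gen K (.vertex a))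

/-- An edge `e` as an element of `L`. -/
noncomputable def edge (e : A) : LeavittPathAlgebra K E := mk K E (.gen K (.edge e))

/-- The ghost edge `e*` as an element of `L`. -/
noncomputable def ghost (e : A) : LeavittPathAlgebra K E := mk K E (.gen K (.ghost e))

/-- The element of `L` given by a path `p` starting at `a`. -/
noncomputable def path : V → List A → LeavittPathAlgebra K E
  | a, [] => vertex K E a
  | _, e :: p => edge K E e * path (E.tgt e) p

/-- The element `p*` of `L` given by the ghost path of a path `p` starting at `a`. -/
noncomputable def ghostPath : V → List A → LeavittPathAlgebra K E
  | a, [] => vertex K E a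
  | _, e :: p => ghostPath (E.tgt e) p * ghost K E e

/-- The homogeneous component `L_n`: the `K`-span of the monomials `α β*` with `α`, `β` paths with
a common end and `|α| - |β| = n`. -/
noncomputable def component (n : ℤ) : Submodule K (LeavittPathAlgebra K E) :=
  Submodule.span K {x | ∃ (a b c : V) (α β : List A), E.IsPath a α c ∧ E.IsPath b β c ∧
    (α.length : ℤ) - β.length = n ∧ x = path K E a α * ghostPath K E b β}

/-- The `ℤ`-grading of `L`, as a family of additive subgroups. -/
noncomputable def grading (n : ℤ) : AddSubgroup (LeavittPathAlgebra K E) :=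
  (component K E n).toAddSubgroup

end LeavittPathAlgebra

/-! ### Modules over a ring without identity

A left module over a possibly non-unital ring `R` (an additive group with a biadditive,
associative action of `R`) is the same thing as a module over the ring `Unitization ℤ R = ℤ ⊕ R`
obtained by adjoining an identity, and the `R`-submodules and `R`-linear maps are the same as the
`Unitization ℤ R`-submodules and `Unitization ℤ R`-linear maps. Likewise "finitely presented" is
`Module.FinitePresentation (Unitization ℤ R)`. -/

section NonUnitalModules

/-- A ring without identity as a left module over itself: `(n + a) • x = n x + a x`. The submodules
are precisely the left ideals of `R`. -/
instance NonUnitalRing.toUnitizationModule (R : Type u) [NonUnitalRing R] :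
    Module (Unitization ℤ R) R where
  smul t x := t.fst • x + t.snd * x
  one_smul x := by
    change (1 : Unitization ℤ R).fst • x + (1 : Unitization ℤ R).snd * x = x
    simp
  mul_smul s t x := by
    change (s * t).fst • x + (s * t).snd * x =
      s.fst • (t.fst • x + t.snd * x) + s.snd * (t.fst • x + t.snd * x)
    simp only [Unitization.fst_mul, Unitization.snd_mul, add_mul, mul_add, smul_add, mul_smul,
      smul_mul_assoc, mul_smul_comm, mul_assoc]
    abel
  smul_zero t := by
    change t.fst • (0 : R) + t.snd * 0 = 0
    simp
  smul_add t x y := by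
    change t.fst • (x + y) + t.snd * (x + y) = (t.fst • x + t.snd * x) + (t.fst • y + t.snd * y)
    rw [smul_add, mul_add]
    abel
  add_smul s t x := by
    change (s + t).fst • x + (s + t).snd * x = (s.fst • x + s.snd * x) + (t.fst • x + t.snd * x)
    rw [Unitization.fst_add, Unitization.snd_add, add_smul, add_mul]
    abel
  zero_smul x := by
    change (0 : Unitization ℤ R).fst • x + (0 : Unitization ℤ R).snd * x = 0
    simp

variable {R : Type u} [NonUnitalRing R] (𝒜 : ℤ → AddSubgroup R)
  {M : Type v} [AddCommGroup M] [Module (Unitization ℤ R) M] (ℳ : ℤ → AddSubgroup M)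

/-- `R M = M`, where `R M` consists of the finite sums of elements `a m`, `a ∈ R`, `m ∈ M`. -/
def IsUnitalModule (R : Type u) [NonUnitalRing R] (M : Type v) [AddCommGroup M]
    [Module (Unitization ℤ R) M] : Prop :=
  AddSubgroup.closure {y : M | ∃ (a : R) (x : M), y = (a : Unitization ℤ R) • x} = ⊤

/-- `M = ⨁ M_n` is a graded left `R`-module, `R` being graded by `𝒜`. -/
structure IsGradedModule : Prop where
  isInternal : DirectSum.IsInternal ℳ
  smul_mem : ∀ (m n : ℤ) (a : R) (x : M), a ∈ 𝒜 m → x ∈ ℳ n →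
    (a : Unitization ℤ R) • x ∈ ℳ (m + n)

/-- The submodule `N` is graded, `N = ⨁ (N ∩ M_n)`: every element of `N` is a sum of homogeneous
elements of `N`. (The sum is automatically direct, because the sum of the `M_n` is.) -/
def IsGradedSubmodule (N : Submodule (Unitization ℤ R) M) : Prop :=
  ∀ x ∈ N, x ∈ AddSubgroup.closure {y : M | y ∈ N ∧ ∃ n, y ∈ ℳ n}

/-- `M` is a graded-simple left `R`-module: a nonzero graded module (with `R M = M`) whose only
graded submodules are `0` and `M`. -/
structure IsGradedSimple : Prop where
  isGraded : IsGradedModule 𝒜 ℳ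
  isUnital : IsUnitalModule R M
  nontrivial : Nontrivial M
  eq_bot_or_eq_top : ∀ N : Submodule (Unitization ℤ R) M, IsGradedSubmodule ℳ N → N = ⊥ ∨ N = ⊤

/-- `I` is a minimal graded left ideal of `R`: minimal among the nonzero graded left ideals. -/
def IsMinimalGradedLeftIdeal (I : Submodule (Unitization ℤ R) R) : Prop :=
  IsGradedSubmodule 𝒜 I ∧ I ≠ ⊥ ∧
    ∀ J : Submodule (Unitization ℤ R) R, IsGradedSubmodule 𝒜 J → J ≤ I → J = ⊥ ∨ J = I

/-- `R` is graded semisimple: it is the direct sum of a family of minimal graded left ideals. -/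
def IsGradedSemisimpleRing : Prop :=
  ∃ S : Set (Submodule (Unitization ℤ R) R), (∀ I ∈ S, IsMinimalGradedLeftIdeal 𝒜 I) ∧
    sSupIndep S ∧ sSup S = ⊤

end NonUnitalModules

/-! Line points and Laurent vertices together are exactly the vertices whose tree contains no
bifurcation (`unbranched_iff`). So (3) says that E is row-finite and that all sufficiently long
paths from a given vertex end at an `Unbranched` vertex. The implications proved are (1) ⇒ (3) ⇒ (2)
⇒ (1).

(1) ⇒ (3). A branching system makes L act on the vector space with basis its elements, and a
suitable degree function makes this module graded-simple (`BranchingSystem.Degree.isGradedSimple`).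
If (3) fails, there is an infinite emitter or, by König's lemma, an infinite path p with infinitely
many bifurcations. The paths ending at the emitter, respectively the infinite paths tail-equivalent
to p, form such a system. The resulting module is cyclic, generated by a basis vector x, and its
relations are not finitely generated. The test for this is a family g_j in L such that each
annihilator of x kills almost all g_j; finite presentation would make "almost all" uniform over the
annihilators (`eventually_forall_smul_eq_zero`). At an emitter the g's are the emitted edges e: here
e* kills x, but e*e ≠ 0. Along p they are the initial segments: a ghost path that leaves p just
after the m-th segment, at a bifurcation, kills x but not that segment.

(3) ⇒ (2). If α ends at an unbranched vertex c, then L α* is a minimal graded left ideal. Indeed,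
the paths q from c are comparable and satisfy q q* = c. Hence a nonzero homogeneous element of L c
can be cleared of ghost edges by right multiplication with some q without loss, and then carried to
a multiple of a vertex by a ghost path. Repeated use of α* = ∑ e (α e)* puts every vertex into the
sum of these ideals. Directness comes from lattice theory: graded left ideals are the submodules
over a ring of operators, and a sum of atoms there is a direct sum of atoms.

(2) ⇒ (1). A graded-simple module is generated by a homogeneous x fixed by some vertex v. The
annihilator of x in L is a graded left ideal, so it has a graded complement. If p is the component
of v in the annihilator, then 1 − v and p generate all relations of x over ℤ ⊕ L. -/

section

/-! ### Paths in a directed graph. -/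

namespace DirectedGraph

variable {V : Type u} {A : Type v} {E : DirectedGraph V A}

theorem isPath_nil_iff {a b : V} : E.IsPath a [] b ↔ a = b :=
  ⟨fun h => by cases h; rfl, fun h => h ▸ .nil a⟩

theorem isPath_cons_iff {a b : V} {e : A} {p : List A} :
    E.IsPath a (e :: p) b ↔ a = E.src e ∧ E.IsPath (E.tgt e) p b :=
  ⟨fun h => by cases h with | cons _ h => exact ⟨rfl, h⟩, fun ⟨h, h'⟩ => h ▸ .cons e h'⟩

theorem IsPath.append {a b c : V} {p q : List A} (hp : E.IsPath a p b) (hq : E.IsPath b q c) :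
    E.IsPath a (p ++ q) c := by
  induction hp with
  | nil => exact hq
  | cons e _ ih => exact .cons e (ih hq)

theorem isPath_append_iff {a c : V} {p q : List A} :
    E.IsPath a (p ++ q) c ↔ ∃ b, E.IsPath a p b ∧ E.IsPath b q c := by
  refine ⟨fun h => ?_, fun ⟨b, hp, hq⟩ => hp.append hq⟩
  induction p generalizing a with
  | nil => exact ⟨a, .nil a, h⟩
  | cons e p ih =>
    obtain ⟨rfl, h'⟩ := isPath_cons_iff.1 h
    obtain ⟨b, hb, hq⟩ := ih h'
    exact ⟨b, .cons e hb, hq⟩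

theorem IsPath.tgt_unique {a b c : V} {p : List A} (h : E.IsPath a p b) (h' : E.IsPath a p c) :
    b = c := by
  induction h with
  | nil => exact isPath_nil_iff.1 h'
  | cons e _ ih => exact ih (isPath_cons_iff.1 h').2

theorem mem_tree_self (a : V) : a ∈ E.tree a := ⟨[], .nil a⟩

theorem tree_trans {a b c : V} (hb : b ∈ E.tree a) (hc : c ∈ E.tree b) : c ∈ E.tree a := by
  obtain ⟨p, hp⟩ := hb
  obtain ⟨q, hq⟩ := hc
  exact ⟨p ++ q, hp.append hq⟩

theorem tgt_mem_tree (e : A) : E.tgt e ∈ E.tree (E.src e) := ⟨[e], .cons e (.nil _)⟩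

end DirectedGraph

/-! ### The universal property of L. -/

open DirectedGraph

/-- A family of elements of an algebra satisfying the defining relations of `L_K(E)`. -/
structure IsLeavittFamily {V : Type u} {A : Type v} (E : DirectedGraph V A) {B : Type*}
    [NonUnitalRing B] (P : V → B) (S T : A → B) : Prop where
  vertex_idem : ∀ a, P a * P a = P a
  vertex_orth : ∀ a b, a ≠ b → P a * P b = 0
  src_edge : ∀ e, P (E.src e) * S e = S e
  edge_tgt : ∀ e, S e * P (E.tgt e) = S e
  tgt_ghost : ∀ e, P (E.tgt e) * T e = T e
  ghost_src : ∀ e, T e * P (E.src e) = T e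
  ck1_same : ∀ e, T e * S e = P (E.tgt e)
  ck1_ne : ∀ e f, e ≠ f → T e * S f = 0
  ck2 : ∀ (a : V) (h : {e | E.src e = a}.Finite), {e | E.src e = a}.Nonempty →
    P a = ∑ e ∈ h.toFinset, S e * T e

namespace LeavittPathAlgebra

variable {K : Type w} [Field K] {V : Type u} {A : Type v} {E : DirectedGraph V A}

section lift

variable {B : Type*} [NonUnitalRing B] [Module K B] [IsScalarTower K B B] [SMulCommClass K B B]

/-- The values of a Leavitt family on the generators. -/
def genVal (P : V → B) (S T : A → B) : LPAGenerator V A → B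
  | .vertex a => P a
  | .edge e => S e
  | .ghost e => T e

/-- The homomorphism on the free algebra given by a family of elements. -/
noncomputable def freeLift (K : Type w) [Field K] {B : Type*} [NonUnitalRing B] [Module K B]
    [IsScalarTower K B B] [SMulCommClass K B B] (P : V → B) (S T : A → B) :
    LPAFree K V A →ₙₐ[K] B :=
  MonoidAlgebra.liftMagma K (FreeSemigroup.lift (genVal P S T))

theorem freeLift_gen (P : V → B) (S T : A → B) (x : LPAGenerator V A) :
    freeLift K P S T (LPAFree.gen K x) = genVal P S T x := by
  simp [freeLift, LPAFree.gen]

theorem freeLift_eq {P : V → B} {S T : A → B} (h : IsLeavittFamily E P S T)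
    {x y : LPAFree K V A} (hxy : ringConGen (LPARel K E) x y) :
    freeLift K P S T x = freeLift K P S T y := by
  have h' : RingConGen.Rel (LPARel K E) x y := hxy
  clear hxy
  induction h' with
  | of x y r =>
    induction r with
    | vertex_idem a => simpa [freeLift_gen, genVal] using h.vertex_idem a
    | vertex_orth a b hab => simpa [freeLift_gen, genVal] using h.vertex_orth a b hab
    | src_edge e => simpa [freeLift_gen, genVal] using h.src_edge e
    | edge_tgt e => simpa [freeLift_gen, genVal] using h.edge_tgt e
    | tgt_ghost e => simpa [freeLift_gen, genVal] using h.tgt_ghost e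
    | ghost_src e => simpa [freeLift_gen, genVal] using h.ghost_src e
    | ck1_same e => simpa [freeLift_gen, genVal] using h.ck1_same e
    | ck1_ne e f hef => simpa [freeLift_gen, genVal] using h.ck1_ne e f hef
    | ck2 a hf hn => simpa only [map_sum, map_mul, freeLift_gen, genVal] using h.ck2 a hf hn
    | smul k _ ih => rw [map_smul, map_smul, ih]
  | refl x => rfl
  | symm _ ih => exact ih.symm
  | trans _ _ ih₁ ih₂ => exact ih₁.trans ih₂
  | add _ _ ih₁ ih₂ => rw [map_add, map_add, ih₁, ih₂]
  | mul _ _ ih₁ ih₂ => rw [map_mul, map_mul, ih₁, ih₂]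

/-- The universal property of the Leavitt path algebra. -/
noncomputable def lift (K : Type w) [Field K] {B : Type*} [NonUnitalRing B] [Module K B]
    [IsScalarTower K B B] [SMulCommClass K B B] {P : V → B} {S T : A → B}
    (h : IsLeavittFamily E P S T) : LeavittPathAlgebra K E →ₙₐ[K] B where
  toFun := Quotient.lift (fun x => freeLift K P S T x) fun _ _ hxy => freeLift_eq h hxy
  map_smul' k x := by
    obtain ⟨x, rfl⟩ := mk_surjective K E x
    exact map_smul (freeLift K P S T) k x
  map_zero' := map_zero (freeLift K P S T)
  map_add' x y := by
    obtain ⟨x, rfl⟩ := mk_surjective K E x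
    obtain ⟨y, rfl⟩ := mk_surjective K E y
    exact map_add (freeLift K P S T) x y
  map_mul' x y := by
    obtain ⟨x, rfl⟩ := mk_surjective K E x
    obtain ⟨y, rfl⟩ := mk_surjective K E y
    exact map_mul (freeLift K P S T) x y

variable {P : V → B} {S T : A → B} (h : IsLeavittFamily E P S T)

theorem lift_vertex (a : V) : lift K h (vertex K E a) = P a := freeLift_gen P S T (.vertex a)

theorem lift_edge (e : A) : lift K h (edge K E e) = S e := freeLift_gen P S T (.edge e)

theorem lift_ghost (e : A) : lift K h (ghost K E e) = T e := freeLift_gen P S T (.ghost e)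

end lift

/-! ### Paths, ghost paths and the monomials α β*. -/

theorem mk_eq {x y : LPAFree K V A} (h : LPARel K E x y) : mk K E x = mk K E y :=
  Quotient.sound (RingConGen.Rel.of _ _ h)

theorem isLeavittFamily : IsLeavittFamily E (vertex K E) (edge K E) (ghost K E) where
  vertex_idem a := by simpa [vertex] using mk_eq (LPARel.vertex_idem (K := K) (E := E) a)
  vertex_orth a b h := by simpa [vertex] using mk_eq (LPARel.vertex_orth (K := K) (E := E) a b h)
  src_edge e := by simpa [vertex, edge] using mk_eq (LPARel.src_edge (K := K) (E := E) e)
  edge_tgt e := by simpa [vertex, edge] using mk_eq (LPARel.edge_tgt (K := K) (E := E) e)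
  tgt_ghost e := by simpa [vertex, ghost] using mk_eq (LPARel.tgt_ghost (K := K) (E := E) e)
  ghost_src e := by simpa [vertex, ghost] using mk_eq (LPARel.ghost_src (K := K) (E := E) e)
  ck1_same e := by simpa [vertex, edge, ghost] using mk_eq (LPARel.ck1_same (K := K) (E := E) e)
  ck1_ne e f h := by simpa [edge, ghost] using mk_eq (LPARel.ck1_ne (K := K) (E := E) e f h)
  ck2 a hf hn := by
    simpa only [vertex, edge, ghost, map_sum, map_mul] using
      mk_eq (LPARel.ck2 (K := K) (E := E) a hf hn)

theorem vertex_mul_self (a : V) : vertex K E a * vertex K E a = vertex K E a :=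
  isLeavittFamily.vertex_idem a

theorem vertex_mul_of_ne {a b : V} (h : a ≠ b) : vertex K E a * vertex K E b = 0 :=
  isLeavittFamily.vertex_orth a b h

theorem vertex_mul_path {a c : V} {p : List A} (h : E.IsPath a p c) :
    vertex K E a * path K E a p = path K E a p := by
  cases h with
  | nil => exact vertex_mul_self a
  | cons e _ => rw [path, ← mul_assoc, isLeavittFamily.src_edge]

theorem path_mul_vertex {a c : V} {p : List A} (h : E.IsPath a p c) :
    path K E a p * vertex K E c = path K E a p := by
  induction h with
  | nil a => exact vertex_mul_self a
  | cons e _ ih => rw [path, mul_assoc, ih]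

theorem ghostPath_mul_vertex {a c : V} {p : List A} (h : E.IsPath a p c) :
    ghostPath K E a p * vertex K E a = ghostPath K E a p := by
  cases h with
  | nil => exact vertex_mul_self a
  | cons e _ => rw [ghostPath, mul_assoc, isLeavittFamily.ghost_src]

theorem vertex_mul_ghostPath {a c : V} {p : List A} (h : E.IsPath a p c) :
    vertex K E c * ghostPath K E a p = ghostPath K E a p := by
  induction h with
  | nil a => exact vertex_mul_self a
  | cons e _ ih => rw [ghostPath, ← mul_assoc, ih]

theorem path_singleton (e : A) (a : V) : path K E a [e] = edge K E e :=
  isLeavittFamily.edge_tgt e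

theorem ghostPath_singleton (e : A) (a : V) : ghostPath K E a [e] = ghost K E e :=
  isLeavittFamily.tgt_ghost e

theorem path_mul_path {a b c : V} {p q : List A} (hp : E.IsPath a p b) (hq : E.IsPath b q c) :
    path K E a p * path K E b q = path K E a (p ++ q) := by
  induction hp with
  | nil a => exact vertex_mul_path hq
  | cons e _ ih => rw [path, mul_assoc, ih hq]; rfl

theorem ghostPath_mul_ghostPath {a b c : V} {p q : List A} (hp : E.IsPath a p b)
    (hq : E.IsPath b q c) :
    ghostPath K E b q * ghostPath K E a p = ghostPath K E a (p ++ q) := by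
  induction hp with
  | nil a => exact ghostPath_mul_vertex hq
  | cons e _ ih => rw [ghostPath, ← mul_assoc, ih hq]; rfl

theorem ghostPath_mul_path_append {a b c : V} {p q : List A} (hp : E.IsPath a p b)
    (hq : E.IsPath b q c) : ghostPath K E a p * path K E a (p ++ q) = path K E b q := by
  induction hp with
  | nil a => exact vertex_mul_path hq
  | cons e h ih =>
    rw [List.cons_append, path, ghostPath, mul_assoc, ← mul_assoc (ghost K E e),
      isLeavittFamily.ck1_same, vertex_mul_path (h.append hq), ih hq]

theorem ghostPath_mul_path_self {a b : V} {p : List A} (hp : E.IsPath a p b) :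
    ghostPath K E a p * path K E a p = vertex K E b := by
  simpa [path] using ghostPath_mul_path_append (K := K) hp (.nil b)

/-- A product `β* α` with `|β| ≤ |α|` vanishes unless `β` is an initial segment of `α`. -/
theorem ghostPath_mul_path_eq_zero {a a' b b' : V} {p q : List A} (hp : E.IsPath a p b)
    (hq : E.IsPath a' q b') (hl : p.length ≤ q.length) (h : a = a' → ¬ p <+: q) :
    ghostPath K E a p * path K E a' q = 0 := by
  induction hp generalizing a' q with
  | nil a =>
    rw [ghostPath, ← vertex_mul_path hq, ← mul_assoc, vertex_mul_of_ne, zero_mul]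
    exact fun ha => h ha List.nil_prefix
  | cons e hp ih =>
    cases hq with
    | nil => simp at hl
    | cons f hq =>
      change ghostPath K E _ _ * ghost K E e * (edge K E f * path K E _ _) = _
      rw [mul_assoc, ← mul_assoc (ghost K E e)]
      by_cases hef : e = f
      · subst hef
        rw [isLeavittFamily.ck1_same, vertex_mul_path hq, ih hq (by simpa using hl)]
        intro _ h'
        exact h rfl (by simpa using h')
      · rw [isLeavittFamily.ck1_ne _ _ hef, zero_mul, mul_zero]

theorem ghostPath_mul_path_of_length_eq {a a' b b' : V} {p q : List A} (hp : E.IsPath a p b)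
    (hq : E.IsPath a' q b') (hl : p.length = q.length) (h : (a, p) ≠ (a', q)) :
    ghostPath K E a p * path K E a' q = 0 :=
  ghostPath_mul_path_eq_zero hp hq hl.le fun ha hpq => h (by rw [ha, hpq.eq_of_length hl])

variable (K E) in
/-- The monomials `α β*`. -/
def monomials : Set (LeavittPathAlgebra K E) :=
  {x | ∃ (a b c : V) (α β : List A), E.IsPath a α c ∧ E.IsPath b β c ∧
    x = path K E a α * ghostPath K E b β}

/-- The relations make every product vanish, lengthen α or shorten α, with one exception: a ghost
edge e* meeting an α of length 0 passes to the ghost part, as e* β* = (β e)*. -/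
theorem gen_mul_monomial (g : LPAGenerator V A) {x : LeavittPathAlgebra K E}
    (hx : x ∈ monomials K E) :
    mk K E (.gen K g) * x = 0 ∨ mk K E (.gen K g) * x ∈ monomials K E := by
  obtain ⟨a, b, c, α, β, hα, hβ, rfl⟩ := hx
  rw [← mul_assoc]
  cases g with
  | vertex d =>
    change vertex K E d * _ * _ = 0 ∨ vertex K E d * _ * _ ∈ _
    by_cases hd : d = a
    · subst hd
      rw [vertex_mul_path hα]
      exact .inr ⟨_, _, _, _, _, hα, hβ, rfl⟩
    · left
      rw [← vertex_mul_path hα, ← mul_assoc, vertex_mul_of_ne hd, zero_mul, zero_mul]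
  | edge e =>
    change edge K E e * _ * _ = 0 ∨ edge K E e * _ * _ ∈ _
    by_cases hd : E.tgt e = a
    · subst hd
      exact .inr ⟨_, _, _, _, _, .cons e hα, hβ, rfl⟩
    · left
      rw [← vertex_mul_path hα, ← mul_assoc, ← isLeavittFamily.edge_tgt, mul_assoc (edge K E e),
        vertex_mul_of_ne hd, mul_zero, zero_mul, zero_mul]
  | ghost e =>
    change ghost K E e * _ * _ = 0 ∨ ghost K E e * _ * _ ∈ _
    cases hα with
    | nil =>
      by_cases hd : E.src e = a
      · subst hd
        right
        refine ⟨E.tgt e, b, E.tgt e, [], β ++ [e], .nil _, hβ.append (.cons e (.nil _)), ?_⟩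
        rw [← ghostPath_mul_ghostPath hβ (.cons e (.nil _)), ghostPath_singleton, path, path,
          isLeavittFamily.ghost_src, ← mul_assoc, isLeavittFamily.tgt_ghost]
      · left
        rw [path, ← isLeavittFamily.ghost_src, mul_assoc (ghost K E e), vertex_mul_of_ne hd,
          mul_zero, zero_mul]
    | cons f hα =>
      rw [path, ← mul_assoc]
      by_cases hef : e = f
      · subst hef
        rw [isLeavittFamily.ck1_same, vertex_mul_path hα]
        exact .inr ⟨_, _, _, _, _, hα, hβ, rfl⟩
      · left
        rw [isLeavittFamily.ck1_ne _ _ hef, zero_mul, zero_mul]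

theorem gen_mem_monomials (g : LPAGenerator V A) : mk K E (.gen K g) ∈ monomials K E := by
  cases g with
  | vertex a => exact ⟨a, a, a, [], [], .nil a, .nil a, (vertex_mul_self a).symm⟩
  | edge e =>
    refine ⟨_, _, _, [e], [], .cons e (.nil _), .nil _, ?_⟩
    rw [ghostPath, path_mul_vertex (.cons e (.nil _)), path_singleton]
    rfl
  | ghost e =>
    refine ⟨_, _, _, [], [e], .nil _, .cons e (.nil _), ?_⟩
    rw [path, vertex_mul_ghostPath (.cons e (.nil _)), ghostPath_singleton]
    rfl

theorem gen_mul_mem_span (g : LPAGenerator V A) {x : LeavittPathAlgebra K E}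
    (hx : x ∈ Submodule.span K (monomials K E)) :
    mk K E (.gen K g) * x ∈ Submodule.span K (monomials K E) := by
  induction hx using Submodule.span_induction with
  | mem x hx =>
    rcases gen_mul_monomial g hx with h | h
    · rw [h]; exact zero_mem _
    · exact Submodule.subset_span h
  | zero => rw [mul_zero]; exact zero_mem _
  | add x y _ _ hx hy => rw [mul_add]; exact add_mem hx hy
  | smul k x _ hx => rw [mul_smul_comm]; exact Submodule.smul_mem _ _ hx

/-- A word in the generators is built by left multiplications, which preserve the span of the
monomials. -/
theorem span_monomials : Submodule.span K (monomials K E) = ⊤ := by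
  rw [eq_top_iff]
  rintro x -
  obtain ⟨x, rfl⟩ := mk_surjective K E x
  induction x using MonoidAlgebra.induction_linear with
  | zero => rw [map_zero]; exact zero_mem _
  | add x y hx hy => rw [map_add]; exact add_mem hx hy
  | single m k =>
    have h1 : (MonoidAlgebra.single m k : LPAFree K V A) = k • MonoidAlgebra.single m 1 := by
      rw [MonoidAlgebra.smul_single, smul_eq_mul, mul_one]
    rw [h1, mk_smul]
    refine Submodule.smul_mem _ _ ?_
    induction m using FreeSemigroup.recOnMul with
    | ih1 g => exact Submodule.subset_span (gen_mem_monomials g)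
    | ih2 g m _ ih =>
      have h2 : (MonoidAlgebra.single (FreeSemigroup.of g * m) 1 : LPAFree K V A) =
          LPAFree.gen K g * MonoidAlgebra.single m 1 := by
        rw [LPAFree.gen, MonoidAlgebra.single_mul_single, mul_one]
      rw [h2, map_mul]
      refine gen_mul_mem_span g (ih ?_)
      rw [MonoidAlgebra.smul_single, smul_eq_mul, mul_one]

theorem monomial_mem_component {a b c : V} {α β : List A} (hα : E.IsPath a α c)
    (hβ : E.IsPath b β c) : path K E a α * ghostPath K E b β ∈
      component K E ((α.length : ℤ) - β.length) :=
  Submodule.subset_span ⟨a, b, c, α, β, hα, hβ, rfl, rfl⟩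

theorem path_mem_component {a c : V} {α : List A} (hα : E.IsPath a α c) :
    path K E a α ∈ component K E α.length := by
  simpa [ghostPath, path_mul_vertex hα] using monomial_mem_component (K := K) hα (.nil c)

theorem vertex_mem_component (a : V) : vertex K E a ∈ component K E 0 := by
  simpa [path] using path_mem_component (K := K) (IsPath.nil (E := E) a)

/-! The grading -/

section grading

variable (K E) in
/-- The element `x T ^ n`. -/
noncomputable def homogeneous (n : ℤ) (x : LeavittPathAlgebra K E) :
    AddMonoidAlgebra (Unitization K (LeavittPathAlgebra K E)) ℤ :=
  AddMonoidAlgebra.single n (x : Unitization K (LeavittPathAlgebra K E))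

theorem homogeneous_mul (m n : ℤ) (x y : LeavittPathAlgebra K E) :
    homogeneous K E m x * homogeneous K E n y = homogeneous K E (m + n) (x * y) := by
  rw [homogeneous, homogeneous, AddMonoidAlgebra.single_mul_single, ← Unitization.inr_mul]
  rfl

theorem homogeneous_zero (n : ℤ) : homogeneous K E n 0 = 0 := by
  rw [homogeneous, Unitization.inr_zero, AddMonoidAlgebra.single_zero]

theorem homogeneous_add (n : ℤ) (x y : LeavittPathAlgebra K E) :
    homogeneous K E n (x + y) = homogeneous K E n x + homogeneous K E n y := by
  rw [homogeneous, Unitization.inr_add, AddMonoidAlgebra.single_add]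
  rfl

theorem homogeneous_smul (n : ℤ) (k : K) (x : LeavittPathAlgebra K E) :
    homogeneous K E n (k • x) = k • homogeneous K E n x := by
  rw [homogeneous, homogeneous, Unitization.inr_smul, AddMonoidAlgebra.smul_single]

theorem homogeneous_sum {ι : Type*} (n : ℤ) (s : Finset ι) (f : ι → LeavittPathAlgebra K E) :
    homogeneous K E n (∑ i ∈ s, f i) = ∑ i ∈ s, homogeneous K E n (f i) :=
  map_sum (⟨⟨homogeneous K E n, homogeneous_zero n⟩, homogeneous_add n⟩ : _ →+ _) f s

/-- The homogeneous Leavitt family `v`, `e T`, `e* T⁻¹`. -/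
theorem isLeavittFamily_homogeneous : IsLeavittFamily E
    (fun a => homogeneous K E 0 (vertex K E a)) (fun e => homogeneous K E 1 (edge K E e))
    (fun e => homogeneous K E (-1) (ghost K E e)) where
  vertex_idem a := by rw [homogeneous_mul, vertex_mul_self, add_zero]
  vertex_orth a b h := by rw [homogeneous_mul, vertex_mul_of_ne h, homogeneous_zero]
  src_edge e := by rw [homogeneous_mul, isLeavittFamily.src_edge, zero_add]
  edge_tgt e := by rw [homogeneous_mul, isLeavittFamily.edge_tgt, add_zero]
  tgt_ghost e := by rw [homogeneous_mul, isLeavittFamily.tgt_ghost, zero_add]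
  ghost_src e := by rw [homogeneous_mul, isLeavittFamily.ghost_src, add_zero]
  ck1_same e := by rw [homogeneous_mul, isLeavittFamily.ck1_same, neg_add_cancel]
  ck1_ne e f h := by rw [homogeneous_mul, isLeavittFamily.ck1_ne _ _ h, homogeneous_zero]
  ck2 a hf hn := by
    simp only [homogeneous_mul, add_neg_cancel]
    rw [isLeavittFamily.ck2 a hf hn, homogeneous_sum]

variable (K E) in
/-- The coaction of `ℤ` on `L_K(E)` that describes the grading. -/
noncomputable def coaction :
    LeavittPathAlgebra K E →ₙₐ[K] AddMonoidAlgebra (Unitization K (LeavittPathAlgebra K E)) ℤ :=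
  lift K isLeavittFamily_homogeneous

theorem coaction_path {a c : V} {p : List A} (h : E.IsPath a p c) :
    coaction K E (path K E a p) = homogeneous K E p.length (path K E a p) := by
  induction h with
  | nil a => exact lift_vertex _ a
  | cons e _ ih =>
    rw [path, map_mul, ih, coaction, lift_edge, homogeneous_mul, List.length_cons, Nat.cast_succ,
      add_comm]

theorem coaction_ghostPath {a c : V} {p : List A} (h : E.IsPath a p c) :
    coaction K E (ghostPath K E a p) = homogeneous K E (-p.length) (ghostPath K E a p) := by
  induction h with
  | nil a => exact lift_vertex _ a
  | cons e _ ih =>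
    rw [ghostPath, map_mul, ih, coaction, lift_ghost, homogeneous_mul, List.length_cons,
      Nat.cast_succ, neg_add]

/-- This makes the grading direct without any basis of L: the coaction sends x in L_n to x T^n, so
the coefficients of the powers of T recover the homogeneous components. -/
theorem coaction_of_mem {n : ℤ} {x : LeavittPathAlgebra K E} (hx : x ∈ component K E n) :
    coaction K E x = homogeneous K E n x := by
  induction hx using Submodule.span_induction with
  | mem x hx =>
    obtain ⟨a, b, c, α, β, hα, hβ, rfl, rfl⟩ := hx
    rw [map_mul, coaction_path hα, coaction_ghostPath hβ, homogeneous_mul, sub_eq_add_neg]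
  | zero => rw [map_zero, homogeneous_zero]
  | add x y _ _ hx hy => rw [map_add, hx, hy, homogeneous_add]
  | smul k x _ hx => rw [map_smul, hx, homogeneous_smul]

variable (K E) in
/-- The projection of `L_K(E)` onto its homogeneous component of degree `n`. -/
noncomputable def proj (n : ℤ) : LeavittPathAlgebra K E →+ LeavittPathAlgebra K E where
  toFun x := ((coaction K E x).coeff n).snd
  map_zero' := by simp
  map_add' x y := by simp

theorem proj_of_mem {n : ℤ} {x : LeavittPathAlgebra K E} (hx : x ∈ component K E n) :
    proj K E n x = x := by
  simp [proj, coaction_of_mem hx, homogeneous, AddMonoidAlgebra.coeff_single,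
    -LaurentPolynomial.single_eq_C_mul_T]

theorem proj_of_mem_of_ne {m n : ℤ} (hmn : m ≠ n) {x : LeavittPathAlgebra K E}
    (hx : x ∈ component K E m) : proj K E n x = 0 := by
  simp [proj, coaction_of_mem hx, homogeneous, AddMonoidAlgebra.coeff_single,
    -LaurentPolynomial.single_eq_C_mul_T, hmn]

theorem exists_eq_sum (x : LeavittPathAlgebra K E) :
    ∃ (s : Finset ℤ) (f : ℤ → LeavittPathAlgebra K E), (∀ n, f n ∈ component K E n) ∧
      x = ∑ n ∈ s, f n := by
  have hx : x ∈ Submodule.span K (monomials K E) := by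
    rw [span_monomials]; exact Submodule.mem_top
  have h : x ∈ ⨆ n, component K E n := by
    refine Submodule.span_le.2 ?_ hx
    rintro _ ⟨a, b, c, α, β, hα, hβ, rfl⟩
    exact Submodule.mem_iSup_of_mem _ (monomial_mem_component hα hβ)
  obtain ⟨f, hf, rfl⟩ := (Submodule.mem_iSup_iff_exists_finsupp _ _).1 h
  exact ⟨f.support, f, hf, rfl⟩

theorem proj_sum (s : Finset ℤ) {f : ℤ → LeavittPathAlgebra K E}
    (hf : ∀ n, f n ∈ component K E n) (m : ℤ) :
    proj K E m (∑ n ∈ s, f n) = if m ∈ s then f m else 0 := by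
  rw [map_sum]
  split_ifs with h
  · rw [Finset.sum_eq_single_of_mem m h fun n _ hn => proj_of_mem_of_ne hn (hf n),
      proj_of_mem (hf m)]
  · exact Finset.sum_eq_zero fun n hn => proj_of_mem_of_ne (by rintro rfl; exact h hn) (hf n)

theorem proj_mem (n : ℤ) (x : LeavittPathAlgebra K E) : proj K E n x ∈ component K E n := by
  obtain ⟨s, f, hf, rfl⟩ := exists_eq_sum x
  rw [proj_sum s hf]
  split_ifs
  · exact hf n
  · exact zero_mem _

theorem exists_eq_sum_proj (x : LeavittPathAlgebra K E) :
    ∃ s : Finset ℤ, x = ∑ n ∈ s, proj K E n x := by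
  obtain ⟨s, f, hf, rfl⟩ := exists_eq_sum x
  refine ⟨s, Finset.sum_congr rfl fun n hn => ?_⟩
  rw [proj_sum s hf, if_pos hn]

end grading

/-! ### Combinations of paths with a common end and a common length. -/

/-- The span of the paths of length `n` that end at `c`. -/
noncomputable def pathSpan (K : Type w) [Field K] (E : DirectedGraph V A) (c : V) (n : ℤ) :
    Submodule K (LeavittPathAlgebra K E) :=
  Submodule.span K {x | ∃ a α, E.IsPath a α c ∧ (α.length : ℤ) = n ∧ x = path K E a α}

theorem pathSpan_eq_range (c : V) (n : ℤ) : pathSpan K E c n = Submodule.span K (Set.range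
    fun q : {q : V × List A // E.IsPath q.1 q.2 c ∧ (q.2.length : ℤ) = n} =>
      path K E q.1.1 q.1.2) := by
  unfold pathSpan
  congr 1
  ext x
  constructor
  · rintro ⟨a, α, hα, hn, rfl⟩
    exact ⟨⟨(a, α), hα, hn⟩, rfl⟩
  · rintro ⟨⟨⟨a, α⟩, hα, hn⟩, rfl⟩
    exact ⟨a, α, hα, hn, rfl⟩

/-- A nonzero combination of paths of the same length is carried to a vertex by a ghost path. -/
theorem exists_ghostPath_mul_eq {c : V} {n : ℤ} {z : LeavittPathAlgebra K E}
    (hz : z ∈ pathSpan K E c n) (h0 : z ≠ 0) : ∃ (a : V) (α : List A) (k : K),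
      E.IsPath a α c ∧ k ≠ 0 ∧ ghostPath K E a α * z = k • vertex K E c := by
  rw [pathSpan_eq_range] at hz
  obtain ⟨f, rfl⟩ := (Finsupp.mem_span_range_iff_exists_finsupp).1 hz
  have hf : f ≠ 0 := by
    rintro rfl
    exact h0 Finsupp.sum_zero_index
  -- No linear independence of paths is presupposed. Any path α with nonzero coefficient works,
  -- since α* annihilates every other path of the same length.
  obtain ⟨⟨⟨a, α⟩, hα, hn⟩, hq⟩ := Finsupp.ne_iff.1 hf
  refine ⟨a, α, f ⟨(a, α), hα, hn⟩, hα, hq, ?_⟩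
  rw [Finsupp.sum, Finset.mul_sum, Finset.sum_eq_single_of_mem ⟨(a, α), hα, hn⟩
    (Finsupp.mem_support_iff.2 hq)]
  · rw [mul_smul_comm, ghostPath_mul_path_self hα]
  · rintro ⟨⟨b, β⟩, hβ, hm⟩ _ hne
    rw [mul_smul_comm, ghostPath_mul_path_of_length_eq hα hβ
      (Nat.cast_injective (R := ℤ) (hn.trans hm.symm)),
      smul_zero]
    rintro h
    simp only [Prod.mk.injEq] at h
    obtain ⟨rfl, rfl⟩ := h
    exact hne rfl

end LeavittPathAlgebra

end

/-! ### Branching systems and their representations. -/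

section

open DirectedGraph

/-- A branching system of a graph: a set `X` on which each edge `e` acts by an injection from the
elements over `r(e)` to the elements over `s(e)`, the images of different edges being disjoint, and
covering the elements over each vertex that emits a nonempty finite set of edges. -/
structure BranchingSystem {V : Type u} {A : Type v} (E : DirectedGraph V A) where
  /-- the underlying set -/
  X : Type (max u v)
  /-- the vertex under an element -/
  src : X → V
  /-- the action of an edge -/
  cons : ∀ (e : A) (x : X), src x = E.tgt e → X
  src_cons : ∀ e x h, src (cons e x h) = E.src e
  cons_inj : ∀ e x h f y h', cons e x h = cons f y h' → e = f ∧ x = y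
  exists_cons : ∀ x, {e | E.src e = src x}.Finite → {e | E.src e = src x}.Nonempty →
    ∃ e y h, x = cons e y h

namespace BranchingSystem

open LeavittPathAlgebra

variable {V : Type u} {A : Type v} {E : DirectedGraph V A} (B : BranchingSystem E)
  (K : Type w) [Field K]

open Classical in
/-- The action of a vertex. -/
noncomputable def vertexEnd (a : V) : Module.End K (B.X →₀ K) :=
  Finsupp.linearCombination K fun x => if B.src x = a then Finsupp.single x 1 else 0

open Classical in
/-- The action of an edge. -/
noncomputable def edgeEnd (e : A) : Module.End K (B.X →₀ K) :=
  Finsupp.linearCombination K fun x =>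
    if h : B.src x = E.tgt e then Finsupp.single (B.cons e x h) 1 else 0

open Classical in
/-- The action of a ghost edge. -/
noncomputable def ghostEnd (e : A) : Module.End K (B.X →₀ K) :=
  Finsupp.linearCombination K fun x =>
    if h : ∃ y, ∃ h : B.src y = E.tgt e, x = B.cons e y h then Finsupp.single h.choose 1 else 0

theorem vertexEnd_of_eq {a : V} {x : B.X} (h : B.src x = a) :
    B.vertexEnd K a (Finsupp.single x 1) = Finsupp.single x 1 := by
  simp [vertexEnd, h]

theorem vertexEnd_of_ne {a : V} {x : B.X} (h : B.src x ≠ a) :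
    B.vertexEnd K a (Finsupp.single x 1) = 0 := by
  simp [vertexEnd, h]

theorem edgeEnd_of_eq {e : A} {x : B.X} (h : B.src x = E.tgt e) :
    B.edgeEnd K e (Finsupp.single x 1) = Finsupp.single (B.cons e x h) 1 := by
  simp [edgeEnd, h]

theorem edgeEnd_of_ne {e : A} {x : B.X} (h : B.src x ≠ E.tgt e) :
    B.edgeEnd K e (Finsupp.single x 1) = 0 := by
  simp [edgeEnd, h]

theorem ghostEnd_cons {e : A} {x : B.X} (h : B.src x = E.tgt e) :
    B.ghostEnd K e (Finsupp.single (B.cons e x h) 1) = Finsupp.single x 1 := by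
  have h' : ∃ y, ∃ h' : B.src y = E.tgt e, B.cons e x h = B.cons e y h' := ⟨x, h, rfl⟩
  have h2 : h'.choose = x := (B.cons_inj _ _ _ _ _ _ h'.choose_spec.choose_spec).2.symm
  simp only [ghostEnd, Finsupp.linearCombination_single, dif_pos h', one_smul, h2]

theorem ghostEnd_of_ne {e : A} {x : B.X} (h : ∀ y h, x ≠ B.cons e y h) :
    B.ghostEnd K e (Finsupp.single x 1) = 0 := by
  have h' : ¬ ∃ y, ∃ h' : B.src y = E.tgt e, x = B.cons e y h' := fun ⟨y, h1, h2⟩ => h y h1 h2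
  simp only [ghostEnd, Finsupp.linearCombination_single, dif_neg h', smul_zero]

theorem end_ext {f g : Module.End K (B.X →₀ K)}
    (h : ∀ x, f (Finsupp.single x 1) = g (Finsupp.single x 1)) : f = g :=
  Finsupp.lhom_ext' fun x => LinearMap.ext_ring (h x)

theorem isLeavittFamily : IsLeavittFamily E (B.vertexEnd K) (B.edgeEnd K) (B.ghostEnd K) where
  vertex_idem a := B.end_ext K fun x => by
    rw [Module.End.mul_apply]
    by_cases h : B.src x = a
    · rw [B.vertexEnd_of_eq K h, B.vertexEnd_of_eq K h]
    · rw [B.vertexEnd_of_ne K h, map_zero]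
  vertex_orth a b hab := B.end_ext K fun x => by
    rw [Module.End.mul_apply, LinearMap.zero_apply]
    by_cases h : B.src x = b
    · rw [B.vertexEnd_of_eq K h, B.vertexEnd_of_ne K (fun h' => hab (h'.symm.trans h))]
    · rw [B.vertexEnd_of_ne K h, map_zero]
  src_edge e := B.end_ext K fun x => by
    rw [Module.End.mul_apply]
    by_cases h : B.src x = E.tgt e
    · rw [B.edgeEnd_of_eq K h, B.vertexEnd_of_eq K (B.src_cons e x h)]
    · rw [B.edgeEnd_of_ne K h, map_zero]
  edge_tgt e := B.end_ext K fun x => by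
    rw [Module.End.mul_apply]
    by_cases h : B.src x = E.tgt e
    · rw [B.vertexEnd_of_eq K h]
    · rw [B.vertexEnd_of_ne K h, map_zero, B.edgeEnd_of_ne K h]
  tgt_ghost e := B.end_ext K fun x => by
    rw [Module.End.mul_apply]
    by_cases h : ∃ y, ∃ h : B.src y = E.tgt e, x = B.cons e y h
    · obtain ⟨y, h, rfl⟩ := h
      rw [B.ghostEnd_cons K h, B.vertexEnd_of_eq K h]
    · rw [B.ghostEnd_of_ne K fun y h1 h2 => h ⟨y, h1, h2⟩, map_zero]
  ghost_src e := B.end_ext K fun x => by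
    rw [Module.End.mul_apply]
    by_cases h : B.src x = E.src e
    · rw [B.vertexEnd_of_eq K h]
    · rw [B.vertexEnd_of_ne K h, map_zero, B.ghostEnd_of_ne]
      rintro y h1 rfl
      exact h (B.src_cons e y h1)
  ck1_same e := B.end_ext K fun x => by
    rw [Module.End.mul_apply]
    by_cases h : B.src x = E.tgt e
    · rw [B.edgeEnd_of_eq K h, B.ghostEnd_cons K h, B.vertexEnd_of_eq K h]
    · rw [B.edgeEnd_of_ne K h, map_zero, B.vertexEnd_of_ne K h]
  ck1_ne e f hef := B.end_ext K fun x => by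
    rw [Module.End.mul_apply, LinearMap.zero_apply]
    by_cases h : B.src x = E.tgt f
    · rw [B.edgeEnd_of_eq K h, B.ghostEnd_of_ne]
      exact fun y h1 h2 => hef (B.cons_inj _ _ _ _ _ _ h2).1.symm
    · rw [B.edgeEnd_of_ne K h, map_zero]
  ck2 a hf hn := B.end_ext K fun x => by
    rw [LinearMap.sum_apply]
    by_cases h : B.src x = a
    · subst h
      obtain ⟨e, y, h, hx⟩ := B.exists_cons x hf hn
      have hs : B.src x = E.src e := by rw [hx, B.src_cons]
      rw [B.vertexEnd_of_eq K rfl, Finset.sum_eq_single_of_mem e (by simpa using hs.symm)]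
      · rw [Module.End.mul_apply, hx, B.ghostEnd_cons K h, B.edgeEnd_of_eq K h]
      · intro f _ hfe
        rw [Module.End.mul_apply, B.ghostEnd_of_ne, map_zero]
        exact fun z h1 h2 => hfe (B.cons_inj _ _ _ _ _ _ (h2.symm.trans hx)).1
    · rw [B.vertexEnd_of_ne K h, Finset.sum_eq_zero]
      intro e he
      rw [Module.End.mul_apply, B.ghostEnd_of_ne, map_zero]
      rintro y h1 rfl
      exact h ((B.src_cons e y h1).trans (by simpa using he))

/-- The representation of `L_K(E)` on the vector space with basis `X`. -/
noncomputable def rep : LeavittPathAlgebra K E →ₙₐ[K] Module.End K (B.X →₀ K) :=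
  lift K (B.isLeavittFamily K)

theorem rep_vertex (a : V) : B.rep K (vertex K E a) = B.vertexEnd K a := lift_vertex _ a

theorem rep_edge (e : A) : B.rep K (edge K E e) = B.edgeEnd K e := lift_edge _ e

theorem rep_ghost (e : A) : B.rep K (ghost K E e) = B.ghostEnd K e := lift_ghost _ e

/-- `B.Extends p y x`: the element `x` is obtained from `y` by the action of the path `p`. -/
inductive Extends : List A → B.X → B.X → Prop
  | nil (y : B.X) : Extends [] y y
  | cons (e : A) {p : List A} {y x : B.X} (hx : Extends p y x) (h : B.src x = E.tgt e) :
      Extends (e :: p) y (B.cons e x h)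

variable {B K}

theorem Extends.isPath {p : List A} {y x : B.X} (h : B.Extends p y x) :
    E.IsPath (B.src x) p (B.src y) := by
  induction h with
  | nil y => exact .nil _
  | cons e _ h ih =>
    rw [B.src_cons]
    exact .cons e (h ▸ ih)

theorem Extends.eq_left {p : List A} {y y' x : B.X} (h : B.Extends p y x)
    (h' : B.Extends p y' x) : y = y' := by
  generalize hx : x = x' at h'
  induction h generalizing y' x' with
  | nil y => cases h'; exact hx
  | cons e _ _ ih =>
    cases h' with
    | cons _ h' _ => exact ih _ (B.cons_inj _ _ _ _ _ _ hx).2 h'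

theorem Extends.eq_right {p : List A} {y x x' : B.X} (h : B.Extends p y x)
    (h' : B.Extends p y x') : x = x' := by
  induction h generalizing x' with
  | nil y => cases h'; rfl
  | cons e _ _ ih =>
    cases h' with
    | cons _ h' _ => cases ih h'; rfl

theorem Extends.append {p q : List A} {x y z : B.X} (h : B.Extends p y x)
    (h' : B.Extends q z y) : B.Extends (p ++ q) z x := by
  induction h with
  | nil => exact h'
  | cons e _ h ih => exact .cons e (ih h') h

theorem rep_path_of_extends {p : List A} {y x : B.X} (h : B.Extends p y x) :
    B.rep K (path K E (B.src x) p) (Finsupp.single y 1) = Finsupp.single x 1 := by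
  induction h with
  | nil y => rw [path, rep_vertex, B.vertexEnd_of_eq K rfl]
  | cons e _ h ih =>
    rw [path, map_mul, Module.End.mul_apply, ← h, ih, rep_edge, B.edgeEnd_of_eq K h]

theorem rep_ghostPath_of_extends {p : List A} {y x : B.X} (h : B.Extends p y x) :
    B.rep K (ghostPath K E (B.src x) p) (Finsupp.single x 1) = Finsupp.single y 1 := by
  induction h with
  | nil y => rw [ghostPath, rep_vertex, B.vertexEnd_of_eq K rfl]
  | cons e _ h ih =>
    rw [ghostPath, map_mul, Module.End.mul_apply, rep_ghost, B.ghostEnd_cons K h, ← h, ih]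

/-- Paths, and likewise ghost paths, act on the basis by partial injections. This dichotomy and the
next reduce computations in the module to the relation `Extends`. -/
theorem rep_path_eq_zero_or {a c : V} {p : List A} (hp : E.IsPath a p c) (y : B.X) :
    B.rep K (path K E a p) (Finsupp.single y 1) = 0 ∨
      ∃ x, B.Extends p y x ∧ B.src x = a ∧
        B.rep K (path K E a p) (Finsupp.single y 1) = Finsupp.single x 1 := by
  induction hp with
  | nil a =>
    by_cases h : B.src y = a
    · exact .inr ⟨y, .nil y, h, by rw [path, rep_vertex, B.vertexEnd_of_eq K h]⟩
    · exact .inl (by rw [path, rep_vertex, B.vertexEnd_of_ne K h])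
  | cons e _ ih =>
    rw [path, map_mul, Module.End.mul_apply, rep_edge]
    rcases ih with h | ⟨x, hx, h, h'⟩
    · exact .inl (by rw [h, map_zero])
    · rw [h', B.edgeEnd_of_eq K h]
      exact .inr ⟨_, .cons e hx h, B.src_cons _ _ _, rfl⟩

theorem rep_ghostPath_eq_zero_or {a c : V} {p : List A} (hp : E.IsPath a p c) (x : B.X) :
    B.rep K (ghostPath K E a p) (Finsupp.single x 1) = 0 ∨
      ∃ y, B.Extends p y x ∧
        B.rep K (ghostPath K E a p) (Finsupp.single x 1) = Finsupp.single y 1 := by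
  induction hp generalizing x with
  | nil a =>
    by_cases h : B.src x = a
    · exact .inr ⟨x, .nil x, by rw [ghostPath, rep_vertex, B.vertexEnd_of_eq K h]⟩
    · exact .inl (by rw [ghostPath, rep_vertex, B.vertexEnd_of_ne K h])
  | cons e _ ih =>
    rw [ghostPath, map_mul, Module.End.mul_apply, rep_ghost]
    by_cases h : ∃ y, ∃ h : B.src y = E.tgt e, x = B.cons e y h
    · obtain ⟨z, h, rfl⟩ := h
      rw [B.ghostEnd_cons K h]
      rcases ih z with h' | ⟨y, hy, h'⟩
      · exact .inl h'
      · exact .inr ⟨y, .cons e hy h, h'⟩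
    · exact .inl (by rw [B.ghostEnd_of_ne K fun y h1 h2 => h ⟨y, h1, h2⟩, map_zero])

theorem vertex_ne_zero_of_src (x : B.X) : vertex K E (B.src x) ≠ 0 := by
  intro h
  have h1 := B.vertexEnd_of_eq K (rfl : B.src x = B.src x)
  rw [← rep_vertex, h, map_zero, LinearMap.zero_apply] at h1
  exact one_ne_zero (Finsupp.single_eq_zero.1 h1.symm)

variable (B K)

/-- The vector space with basis `X` as a module over `ℤ ⊕ L_K(E)`. -/
noncomputable instance : Module (Unitization ℤ (LeavittPathAlgebra K E)) (B.X →₀ K) where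
  smul t x := t.fst • x + B.rep K t.snd x
  one_smul x := by
    change (1 : Unitization ℤ _).fst • x + B.rep K (1 : Unitization ℤ _).snd x = x
    simp
  mul_smul s t x := by
    change (s * t).fst • x + B.rep K (s * t).snd x =
      s.fst • (t.fst • x + B.rep K t.snd x) + B.rep K s.snd (t.fst • x + B.rep K t.snd x)
    have h2 : B.rep K (s * t).snd x =
        s.fst • B.rep K t.snd x + t.fst • B.rep K s.snd x + B.rep K s.snd (B.rep K t.snd x) := by
      rw [Unitization.snd_mul, map_add, map_add, map_mul, map_zsmul, map_zsmul]
      rfl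
    rw [h2, Unitization.fst_mul, mul_smul, smul_add, map_add, map_zsmul]
    abel
  smul_zero t := by
    change t.fst • (0 : B.X →₀ K) + B.rep K t.snd 0 = 0
    simp
  smul_add t x y := by
    change t.fst • (x + y) + B.rep K t.snd (x + y) =
      (t.fst • x + B.rep K t.snd x) + (t.fst • y + B.rep K t.snd y)
    rw [smul_add, map_add]
    exact add_add_add_comm _ _ _ _
  add_smul s t x := by
    change (s + t).fst • x + B.rep K (s + t).snd x =
      (s.fst • x + B.rep K s.snd x) + (t.fst • x + B.rep K t.snd x)
    rw [Unitization.snd_add, map_add, Unitization.fst_add, add_smul, LinearMap.add_apply]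
    exact add_add_add_comm _ _ _ _
  zero_smul x := by
    change (0 : Unitization ℤ _).fst • x + B.rep K (0 : Unitization ℤ _).snd x = 0
    simp

variable {B K}

theorem inr_smul (a : LeavittPathAlgebra K E) (m : B.X →₀ K) :
    (a : Unitization ℤ (LeavittPathAlgebra K E)) • m = B.rep K a m := by
  change (a : Unitization ℤ (LeavittPathAlgebra K E)).fst • m +
    B.rep K (a : Unitization ℤ (LeavittPathAlgebra K E)).snd m = _
  simp

/-! ### Graded-simple modules from branching systems. -/

variable (B) in
/-- A degree function on a branching system, such that any two elements have a common tail and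
elements of the same degree are told apart by an initial segment. -/
structure Degree where
  /-- the degree of an element -/
  deg : B.X → ℤ
  deg_cons : ∀ e x h, deg (B.cons e x h) = deg x + 1
  connected : ∀ x y, ∃ p q z, B.Extends p z x ∧ B.Extends q z y
  separated : ∀ x y, x ≠ y → deg x = deg y → ∃ p, (∃ z, B.Extends p z x) ∧ ∀ z, ¬ B.Extends p z y

namespace Degree

variable (d : B.Degree)

theorem deg_extends {p : List A} {y x : B.X} (h : B.Extends p y x) :
    d.deg x = d.deg y + p.length := by
  induction h with
  | nil => simp
  | cons e _ h ih => rw [d.deg_cons, ih, List.length_cons, Nat.cast_succ, add_assoc]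

variable (K) in
/-- The homogeneous component of degree `n` of the module. -/
noncomputable def component (n : ℤ) : Submodule K (B.X →₀ K) :=
  Finsupp.supported K K {x | d.deg x = n}

variable (K) in
/-- The homogeneous component of degree `n` of the module, as an additive subgroup. -/
noncomputable def grading (n : ℤ) : AddSubgroup (B.X →₀ K) := (d.component K n).toAddSubgroup

theorem mem_component {n : ℤ} {m : B.X →₀ K} :
    m ∈ d.component K n ↔ ∀ x, m x ≠ 0 → d.deg x = n := by
  rw [component, Finsupp.mem_supported]
  exact ⟨fun h x hx => h (by simpa using hx), fun h x hx => h x (by simpa using hx)⟩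

theorem single_mem_component (x : B.X) (k : K) : Finsupp.single x k ∈ d.component K (d.deg x) :=
  Finsupp.single_mem_supported K k rfl

theorem isInternal : DirectSum.IsInternal (d.grading K) := by
  have h : DirectSum.IsInternal (d.component K) := by
    refine (DirectSum.isInternal_submodule_iff_iSupIndep_and_iSup_eq_top _).2 ⟨?_, ?_⟩
    · intro n
      have h2 : ⨆ (j) (_ : j ≠ n), d.component K j ≤ Finsupp.supported K K {x | d.deg x ≠ n} :=
        iSup₂_le fun j hj => Finsupp.supported_mono fun x (hx : d.deg x = j) =>
          (hx.trans_ne hj : d.deg x ≠ n)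
      refine Disjoint.mono_right h2 (Finsupp.disjoint_supported_supported ?_)
      exact Set.disjoint_left.2 fun x hx hx' => hx' hx
    · have h2 : ⨆ n, d.component K n = Finsupp.supported K K (⋃ n, {x | d.deg x = n}) :=
        (Finsupp.supported_iUnion _).symm
      rw [h2, eq_top_iff, ← Finsupp.supported_univ]
      exact Finsupp.supported_mono fun x _ => Set.mem_iUnion.2 ⟨d.deg x, rfl⟩
  exact h

theorem rep_mem_component {m n : ℤ} {a : LeavittPathAlgebra K E} {x : B.X →₀ K}
    (ha : a ∈ LeavittPathAlgebra.component K E m) (hx : x ∈ d.component K n) :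
    B.rep K a x ∈ d.component K (m + n) := by
  rw [component, Finsupp.supported_eq_span_single] at hx
  induction ha using Submodule.span_induction with
  | mem a ha =>
    obtain ⟨b, b', c, α, β, hα, hβ, rfl, rfl⟩ := ha
    induction hx using Submodule.span_induction with
    | mem x hx =>
      obtain ⟨x, rfl, rfl⟩ := hx
      dsimp only
      rw [map_mul, Module.End.mul_apply]
      rcases rep_ghostPath_eq_zero_or (K := K) hβ x with h | ⟨y, hy, h⟩
      · rw [h, map_zero]; exact zero_mem _
      rw [h]
      rcases rep_path_eq_zero_or (K := K) hα y with h | ⟨z, hz, -, h⟩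
      · rw [h]; exact zero_mem _
      rw [h, d.deg_extends hy]
      have hdeg : (α.length : ℤ) - β.length + (d.deg y + β.length) = d.deg z := by
        rw [d.deg_extends hz]
        ring
      rw [hdeg]
      exact d.single_mem_component z 1
    | zero => rw [map_zero]; exact zero_mem _
    | add x y _ _ hx hy => rw [map_add]; exact add_mem hx hy
    | smul k x _ hx => rw [map_smul]; exact Submodule.smul_mem _ _ hx
  | zero => rw [map_zero]; exact zero_mem _
  | add a b _ _ ha hb => rw [map_add]; exact add_mem ha hb
  | smul k a _ ha => rw [map_smul]; exact Submodule.smul_mem _ _ ha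

theorem isGradedModule : IsGradedModule (LeavittPathAlgebra.grading K E) (d.grading K) where
  isInternal := d.isInternal
  smul_mem m n a x ha hx := by
    rw [inr_smul]
    exact d.rep_mem_component ha hx

end Degree

theorem rep_smul_vertex (k : K) (x : B.X) (k' : K) :
    B.rep K (k • vertex K E (B.src x)) (Finsupp.single x k') = Finsupp.single x (k * k') := by
  rw [← mul_one k', ← smul_eq_mul k' 1, ← Finsupp.smul_single, map_smul, map_smul, rep_vertex,
    LinearMap.smul_apply, B.vertexEnd_of_eq K rfl]
  simp [mul_comm]

theorem isUnitalModule : IsUnitalModule (LeavittPathAlgebra K E) (B.X →₀ K) := by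
  rw [IsUnitalModule, eq_top_iff]
  rintro m -
  refine Finsupp.induction_linear (motive := fun m : B.X →₀ K => m ∈
    AddSubgroup.closure {y : B.X →₀ K | ∃ (a : LeavittPathAlgebra K E) (x : B.X →₀ K),
      y = (a : Unitization ℤ (LeavittPathAlgebra K E)) • x}) m (zero_mem _)
    (fun x y hx hy => add_mem hx hy) fun x k => AddSubgroup.subset_closure ?_
  refine ⟨(1 : K) • vertex K E (B.src x), (Finsupp.single x k : B.X →₀ K), ?_⟩
  rw [inr_smul, rep_smul_vertex, one_mul]

namespace Degree

variable (d : B.Degree)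

/-- The support of m is shrunk by ghost paths. If x ≠ y both occur in m, they have equal degree, so
some initial segment p of x is not one of y; applying p* keeps the coefficient of x and loses that
of y. Since p* is injective where it does not vanish, no new basis elements compensate for the loss.
-/
theorem exists_single_mem (N : Submodule (Unitization ℤ (LeavittPathAlgebra K E)) (B.X →₀ K))
    {n : ℤ} {m : B.X →₀ K} (hm : m ∈ d.component K n) (hN : m ∈ N) (h0 : m ≠ 0) :
    ∃ x, (Finsupp.single x 1 : B.X →₀ K) ∈ N := by
  classical
  induction hc : m.support.card using Nat.strong_induction_on generalizing m n with
  | _ c ih =>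
  obtain ⟨x, hx⟩ := Finsupp.support_nonempty_iff.2 h0
  rw [Finsupp.mem_support_iff] at hx
  by_cases h : ∃ y, y ≠ x ∧ m y ≠ 0
  · obtain ⟨y, hyx, hy⟩ := h
    rw [mem_component] at hm
    obtain ⟨p, ⟨z, hz⟩, hp⟩ := d.separated x y hyx.symm ((hm x hx).trans (hm y hy).symm)
    set g : LeavittPathAlgebra K E := ghostPath K E (B.src x) p with hg
    have hsum : B.rep K g m = m.sum fun w k => k • B.rep K g (Finsupp.single w 1) := by
      conv_lhs => rw [← Finsupp.sum_single m, Finsupp.sum, map_sum]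
      refine Finset.sum_congr rfl fun w _ => ?_
      dsimp only
      rw [← map_smul, Finsupp.smul_single, smul_eq_mul, mul_one]
    have hval : ∀ z', B.rep K g m z' ≠ 0 → ∃ w, m w ≠ 0 ∧ B.Extends p z' w := by
      intro z' hz'
      rw [hsum, Finsupp.sum, Finset.sum_apply'] at hz'
      obtain ⟨w, hw, hw'⟩ := Finset.exists_ne_zero_of_sum_ne_zero hz'
      refine ⟨w, by simpa using hw, ?_⟩
      rcases rep_ghostPath_eq_zero_or (K := K) hz.isPath w with h | ⟨z₁, h1, h⟩
      · rw [h] at hw'; simp at hw'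
      · rw [h] at hw'
        have : z₁ = z' := by
          by_contra hne
          simp [hne] at hw'
        exact this ▸ h1
    have hz0 : B.rep K g m z = m x := by
      rw [hsum, Finsupp.sum, Finset.sum_apply', Finset.sum_eq_single_of_mem x (by simpa using hx)]
      · rw [rep_ghostPath_of_extends hz]; simp
      · intro w _ hw
        rcases rep_ghostPath_eq_zero_or (K := K) hz.isPath w with h | ⟨z₁, h1, h⟩
        · rw [h]; simp
        · rw [h]
          have : z₁ ≠ z := by
            rintro rfl
            exact hw (h1.eq_right hz)
          simp [this]
    -- `F` assigns to each element in the new support the element of the old one it was cut from. It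
    -- is injective, as p and the longer element determine the tail, and it misses y.
    choose! F hF hF' using hval
    refine ih (m := (B.rep K g m).support.card) ?_ (n := n - p.length) ?_ ?_ ?_ rfl
    · rw [← hc, ← Finset.card_image_of_injOn (f := F)]
      · refine Finset.card_lt_card ((Finset.ssubset_iff_of_subset ?_).2 ⟨y, by simpa using hy, ?_⟩)
        · intro w hw
          obtain ⟨z', hz', rfl⟩ := Finset.mem_image.1 hw
          exact Finsupp.mem_support_iff.2 (hF z' (Finsupp.mem_support_iff.1 hz'))
        · intro hw
          obtain ⟨z', hz', rfl⟩ := Finset.mem_image.1 hw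
          exact hp z' (hF' z' (Finsupp.mem_support_iff.1 hz'))
      · intro z₁ h1 z₂ h2 h12
        have e1 := hF' z₁ (Finsupp.mem_support_iff.1 h1)
        have e2 := hF' z₂ (Finsupp.mem_support_iff.1 h2)
        rw [← h12] at e2
        exact e1.eq_left e2
    · rw [mem_component]
      intro z' hz'
      rw [← hm _ (hF z' hz'), d.deg_extends (hF' z' hz')]
      ring
    · have := N.smul_mem (g : Unitization ℤ (LeavittPathAlgebra K E)) hN
      rwa [inr_smul] at this
    · intro h
      rw [h] at hz0
      exact hx hz0.symm
  · push Not at h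
    have hm' : m = Finsupp.single x (m x) := by
      ext y
      by_cases hy : y = x
      · subst hy; simp
      · rw [h y hy]; simp [Ne.symm hy]
    refine ⟨x, ?_⟩
    -- N is a submodule only over ℤ ⊕ L, so scalars of K must act through multiples of a vertex.
    have := N.smul_mem (((m x)⁻¹ • vertex K E (B.src x) : LeavittPathAlgebra K E) :
      Unitization ℤ (LeavittPathAlgebra K E)) hN
    rw [inr_smul, hm', rep_smul_vertex] at this
    simpa [hx] using this

/-- Any two basis elements share a tail: a ghost path cuts the first down to it, and a path extends
it to the second. -/
theorem eq_top_of_single_mem (d : B.Degree)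
    (N : Submodule (Unitization ℤ (LeavittPathAlgebra K E)) (B.X →₀ K))
    {x : B.X} (hx : (Finsupp.single x 1 : B.X →₀ K) ∈ N) : N = ⊤ := by
  rw [eq_top_iff]
  rintro m -
  refine Finsupp.induction_linear (motive := fun m : B.X →₀ K => m ∈ N) m
    (zero_mem _) (fun x y hx hy => add_mem hx hy) fun y k => ?_
  obtain ⟨p, q, z, hp, hq⟩ := d.connected x y
  have h1 := N.smul_mem (ghostPath K E (B.src x) p : Unitization ℤ (LeavittPathAlgebra K E)) hx
  rw [inr_smul, rep_ghostPath_of_extends hp] at h1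
  have h2 := N.smul_mem (path K E (B.src y) q : Unitization ℤ (LeavittPathAlgebra K E)) h1
  rw [inr_smul, rep_path_of_extends hq] at h2
  have h3 := N.smul_mem ((k • vertex K E (B.src y) : LeavittPathAlgebra K E) :
    Unitization ℤ (LeavittPathAlgebra K E)) h2
  rwa [inr_smul, rep_smul_vertex, mul_one] at h3

end Degree

end BranchingSystem

theorem IsGradedSubmodule.exists_homogeneous {R : Type*} [NonUnitalRing R] {M : Type*}
    [AddCommGroup M] [Module (Unitization ℤ R) M] {ℳ : ℤ → AddSubgroup M}
    {N : Submodule (Unitization ℤ R) M} (hN : IsGradedSubmodule ℳ N) (h0 : N ≠ ⊥) :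
    ∃ n, ∃ x ∈ N, x ∈ ℳ n ∧ x ≠ 0 := by
  obtain ⟨x, hx, hx0⟩ := N.ne_bot_iff.1 h0
  by_contra! h
  have : x ∈ (⊥ : AddSubgroup M) := by
    refine (AddSubgroup.closure_le _).2 ?_ (hN x hx)
    rintro y ⟨hy, n, hn⟩
    exact h n y hy hn
  exact hx0 this

theorem BranchingSystem.Degree.isGradedSimple {V : Type u} {A : Type v} {E : DirectedGraph V A}
    {B : BranchingSystem E} {K : Type w} [Field K] (d : B.Degree) [Nonempty B.X] :
    IsGradedSimple (LeavittPathAlgebra.grading K E) (d.grading K) where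
  isGraded := d.isGradedModule
  isUnital := B.isUnitalModule
  nontrivial := inferInstanceAs (Nontrivial (B.X →₀ K))
  eq_bot_or_eq_top N hN := by
    by_cases h : N = ⊥
    · exact .inl h
    obtain ⟨n, m, hm, hn, h0⟩ := hN.exists_homogeneous h
    obtain ⟨x, hx⟩ := d.exists_single_mem N hn hm h0
    exact .inr (d.eq_top_of_single_mem N hx)

end

section

namespace DirectedGraph

variable {V : Type u} {A : Type v} {E : DirectedGraph V A}

/-! ### Vertices whose tree contains no bifurcation -/

variable (E) in
/-- No vertex of the tree of `a` is a bifurcation. -/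
def Unbranched (a : V) : Prop := ∀ b ∈ E.tree a, ¬ E.IsBifurcation b

theorem Unbranched.of_mem_tree {a b : V} (h : E.Unbranched a) (hb : b ∈ E.tree a) :
    E.Unbranched b := fun _ hc => h _ (tree_trans hb hc)

theorem eq_of_not_isBifurcation {a : V} (h : ¬ E.IsBifurcation a) {e f : A} (he : E.src e = a)
    (hf : E.src f = a) : e = f := by
  by_contra hef
  exact h ⟨e, f, hef, he, hf⟩

theorem IsPath.tgt_mem_tree {a b : V} {p : List A} (h : E.IsPath a p b) {e : A} (he : e ∈ p) :
    E.tgt e ∈ E.tree a := by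
  induction h with
  | nil => simp at he
  | cons f _ ih =>
    refine tree_trans (E.tgt_mem_tree f) ?_
    rcases List.mem_cons.1 he with rfl | he
    · exact E.mem_tree_self _
    · exact ih he

theorem IsPath.src_mem_tree {a b : V} {p : List A} (h : E.IsPath a p b) {e : A} (he : e ∈ p) :
    E.src e ∈ E.tree a := by
  induction h with
  | nil => simp at he
  | cons f _ ih =>
    rcases List.mem_cons.1 he with rfl | he
    · exact E.mem_tree_self _
    · exact tree_trans (E.tgt_mem_tree f) (ih he)

theorem IsPath.pathVertices_subset {a b : V} {p : List A} (h : E.IsPath a p b) :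
    E.pathVertices a p ⊆ E.tree a := by
  rintro x (rfl | ⟨e, he, rfl⟩)
  · exact E.mem_tree_self _
  · exact h.tgt_mem_tree he

/-- Each vertex of a path other than its end is the source of an edge of the path. -/
theorem IsPath.eq_or_exists_src {a b x : V} {p : List A} (h : E.IsPath a p b)
    (hx : x ∈ E.pathVertices a p) : x = b ∨ ∃ e ∈ p, x = E.src e := by
  induction h with
  | nil =>
    rcases hx with rfl | ⟨e, he, -⟩
    · exact .inl rfl
    · simp at he
  | @cons e p b h ih =>
    by_cases hxe : x = E.src e
    · exact .inr ⟨e, by simp, hxe⟩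
    have hx' : x ∈ E.pathVertices (E.tgt e) p := by
      rcases hx with hx | ⟨f, hf, rfl⟩
      · exact absurd hx hxe
      · rcases List.mem_cons.1 hf with rfl | hf
        · exact .inl rfl
        · exact .inr ⟨f, hf, rfl⟩
    rcases ih hx' with h' | ⟨f, hf, h'⟩
    · exact .inl h'
    · exact .inr ⟨f, List.mem_cons_of_mem _ hf, h'⟩

theorem IsPath.exists_src_of_closed {b : V} {c : List A} (hc : c ≠ []) (h : E.IsPath b c b) :
    ∃ e ∈ c, b = E.src e := by
  cases h with
  | nil => exact absurd rfl hc
  | cons e _ => exact ⟨e, by simp, rfl⟩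

theorem tree_subset_of_closed {a : V} {S : Set V} (ha : a ∈ S)
    (hS : ∀ e, E.src e ∈ S → E.tgt e ∈ S) : E.tree a ⊆ S := by
  rintro b ⟨p, hp⟩
  induction hp with
  | nil => exact ha
  | cons e _ ih => exact ih (hS e ha)

/-- Without bifurcations the tree of a is traced by a single path. If it contains the base of a
cycle c, reached by μ, then the vertices of μ c are closed under taking edges and so exhaust the
tree. Otherwise a is a line point. -/
theorem unbranched_iff {a : V} :
    E.Unbranched a ↔ E.IsLinePoint a ∨ E.IsLaurentVertex a := by
  constructor
  · intro h
    by_cases hc : ∃ b ∈ E.tree a, ∃ c, E.IsCycle b c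
    · obtain ⟨b, ⟨μ, hμ⟩, c, hc⟩ := hc
      have hμc := hμ.append hc.2.1
      refine .inr ⟨b, μ, c, hμ, fun x hx => h x (hμ.pathVertices_subset hx), hc, ?_, ?_⟩
      · intro e he f hf
        exact eq_of_not_isBifurcation (h _ (hμc.src_mem_tree (List.mem_append_right _ he))) hf rfl
      · refine (tree_subset_of_closed (.inl rfl) fun e he => ?_).antisymm
          hμc.pathVertices_subset
        -- Every vertex on μ c emits an edge of μ c: its end is the base of c, which emits the first
        -- edge of c.
        have : ∃ f ∈ μ ++ c, E.src e = E.src f := by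
          rcases hμc.eq_or_exists_src he with h' | h'
          · obtain ⟨f, hf, h2⟩ := hc.2.1.exists_src_of_closed hc.1
            exact ⟨f, List.mem_append_right _ hf, h'.trans h2⟩
          · exact h'
        obtain ⟨f, hf, hef⟩ := this
        obtain rfl := eq_of_not_isBifurcation (h _ (hμc.src_mem_tree hf)) hef rfl
        exact .inr ⟨e, hf, rfl⟩
    · exact .inl fun b hb => ⟨h b hb, fun hb' => hc ⟨b, hb, hb'⟩⟩
  · rintro (h | ⟨b, μ, c, hμ, hbif, hc, hexit, htree⟩) x hx
    · exact (h x hx).1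
    · rw [htree] at hx
      have : x ∈ E.pathVertices a μ ∨ x ∈ E.pathVertices b c := by
        rcases hx with rfl | ⟨e, he, rfl⟩
        · exact .inl (.inl rfl)
        · rcases List.mem_append.1 he with he | he
          · exact .inl (.inr ⟨e, he, rfl⟩)
          · exact .inr (.inr ⟨e, he, rfl⟩)
      rcases this with hx | hx
      · exact hbif x hx
      · have : ∃ e ∈ c, x = E.src e := by
          rcases hc.2.1.eq_or_exists_src hx with rfl | h'
          · exact hc.2.1.exists_src_of_closed hc.1
          · exact h'
        obtain ⟨e, he, rfl⟩ := this
        rintro ⟨f, g, hfg, hf, hg⟩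
        exact hfg ((hexit e he f hf).trans (hexit e he g hg).symm)

/-- Two paths with the same source in a tree without bifurcations are comparable. -/
theorem Unbranched.prefix_of_length_le {a b c : V} {p q : List A} (h : E.Unbranched a)
    (hp : E.IsPath a p b) (hq : E.IsPath a q c) (hl : p.length ≤ q.length) : p <+: q := by
  induction hp generalizing q with
  | nil => exact List.nil_prefix
  | cons e hp ih =>
    generalize ha : E.src e = a at hq h
    cases hq with
    | nil => simp at hl
    | cons f hq =>
      obtain rfl := eq_of_not_isBifurcation (h _ (E.mem_tree_self _)) ha rfl
      rw [List.cons_prefix_cons]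
      exact ⟨rfl, ih (h.of_mem_tree (E.tgt_mem_tree e)) hq (by simpa using hl)⟩

/-! ### Infinite paths -/

variable (E) in
/-- The sequence of edges `p` is an infinite path. -/
def IsInfinitePath (p : ℕ → A) : Prop := ∀ i, E.tgt (p i) = E.src (p (i + 1))

/-- The initial segment of length `n` of an infinite path. -/
def initial (p : ℕ → A) (n : ℕ) : List A := (List.range n).map p

theorem length_initial (p : ℕ → A) (n : ℕ) : (initial p n).length = n := by simp [initial]

theorem initial_succ (p : ℕ → A) (n : ℕ) : initial p (n + 1) = initial p n ++ [p n] := by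
  simp [initial, List.range_succ]

theorem initial_succ' (p : ℕ → A) (n : ℕ) :
    initial p (n + 1) = p 0 :: initial (fun i => p (i + 1)) n := by
  simp [initial, List.range_succ_eq_map, Function.comp_def]

theorem IsInfinitePath.isPath {p : ℕ → A} (h : E.IsInfinitePath p) (n : ℕ) :
    E.IsPath (E.src (p 0)) (initial p n) (E.src (p n)) := by
  induction n with
  | zero => exact .nil _
  | succ n ih =>
    rw [initial_succ]
    refine ih.append (.cons _ ?_)
    rw [h n]
    exact .nil _

theorem exists_isInfinitePath {P : V → Prop} (hP : ∀ a, P a → ∃ e, E.src e = a ∧ P (E.tgt e))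
    {a : V} (ha : P a) :
    ∃ p, E.IsInfinitePath p ∧ E.src (p 0) = a ∧ ∀ i, P (E.src (p i)) := by
  choose F hF hF' using hP
  let s : ℕ → {a // P a} := fun n => Nat.rec ⟨a, ha⟩ (fun _ b => ⟨E.tgt (F b.1 b.2), hF' _ _⟩) n
  refine ⟨fun n => F (s n).1 (s n).2, fun i => ?_, hF _ _, fun i => ?_⟩
  · exact (hF (s (i + 1)).1 (s (i + 1)).2).symm
  · exact (hF (s i).1 (s i).2).symm ▸ (s i).2

/-- If an infinite path has no bifurcations then its vertices exhaust the tree of its source. -/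
theorem IsInfinitePath.exists_src_eq {p : ℕ → A} (h : E.IsInfinitePath p) {m : ℕ}
    (hm : ∀ n, m ≤ n → ¬ E.IsBifurcation (E.src (p n))) {b : V}
    (hb : b ∈ E.tree (E.src (p m))) : ∃ n, m ≤ n ∧ b = E.src (p n) := by
  refine tree_subset_of_closed (S := {b | ∃ n, m ≤ n ∧ b = E.src (p n)}) ⟨m, le_rfl, rfl⟩ ?_ hb
  rintro e ⟨n, hn, he⟩
  obtain rfl := eq_of_not_isBifurcation (hm n hn) he rfl
  exact ⟨n + 1, by omega, h n⟩

/-- A form of König's lemma: if the paths from `a` to branched trees are arbitrarily long, there is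
an infinite path with infinitely many bifurcations. -/
theorem RowFinite.exists_isInfinitePath (hE : E.RowFinite) {a : V}
    (ha : ∀ n : ℕ, ∃ (p : List A) (b : V), E.IsPath a p b ∧ n ≤ p.length ∧ ¬ E.Unbranched b) :
    ∃ p, E.IsInfinitePath p ∧ ∀ m : ℕ, ∃ n, m ≤ n ∧ E.IsBifurcation (E.src (p n)) := by
  have step : ∀ a, (∀ n : ℕ, ∃ (p : List A) (b : V), E.IsPath a p b ∧ n ≤ p.length ∧
      ¬ E.Unbranched b) → ∃ e, E.src e = a ∧ ∀ n : ℕ, ∃ (p : List A) (b : V),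
      E.IsPath (E.tgt e) p b ∧ n ≤ p.length ∧ ¬ E.Unbranched b := by
    intro a ha
    by_contra! hno
    have hno' : ∀ e, ∃ n : ℕ, E.src e = a → ∀ (p : List A) (b : V), E.IsPath (E.tgt e) p b →
        n ≤ p.length → E.Unbranched b := by
      intro e
      by_cases he : E.src e = a
      · obtain ⟨n, hn⟩ := hno e he
        exact ⟨n, fun _ => hn⟩
      · exact ⟨0, fun h => absurd h he⟩
    choose N hN using hno'
    -- If every edge e at a had a bound N e, the maximum over the finitely many such e, plus one for
    -- the first edge, would be a bound at a.
    obtain ⟨p, b, hp, hl, hb⟩ := ha ((hE a).toFinset.sup N + 1)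
    cases hp with
    | nil => simp at hl
    | cons e hp =>
      refine hb (hN e rfl _ _ hp ?_)
      have : N e ≤ (hE (E.src e)).toFinset.sup N := Finset.le_sup (by simp)
      rw [List.length_cons] at hl
      omega
  obtain ⟨p, hp, -, h⟩ := DirectedGraph.exists_isInfinitePath step ha
  refine ⟨p, hp, fun m => ?_⟩
  -- If p had no bifurcation from m on, its vertices would exhaust the tree of its m-th vertex; but
  -- that tree contains a vertex that is not unbranched.
  by_contra! hm
  obtain ⟨q, b, hq, -, hb⟩ := h m 0
  refine hb fun c hc => ?_
  obtain ⟨n, hn, rfl⟩ := hp.exists_src_eq hm (tree_trans ⟨q, hq⟩ hc)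
  exact hm n hn

end DirectedGraph

end

/-! ### Finite presentation and annihilators. -/

section

open DirectedGraph LeavittPathAlgebra Filter

variable {V : Type u} {A : Type v} {E : DirectedGraph V A} {K : Type w} [Field K]

theorem unitization_smul_inr {R : Type*} [NonUnitalRing R] (t : Unitization ℤ R) (a : R) :
    ((t • a : R) : Unitization ℤ R) = t * (a : Unitization ℤ R) := by
  change ((t.fst • a + t.snd * a : R) : Unitization ℤ R) = t * (a : Unitization ℤ R)
  conv_rhs => rw [← Unitization.inl_fst_add_inr_snd_eq t, add_mul, ← Unitization.inr_mul,
    Unitization.inl_mul_inr]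
  rw [Unitization.inr_add]

theorem unitization_smul_mul {R : Type*} [NonUnitalRing R] (t : Unitization ℤ R) (a b : R) :
    t • (a * b) = (t • a) * b := by
  change t.fst • (a * b) + t.snd * (a * b) = (t.fst • a + t.snd * a) * b
  rw [add_mul, smul_mul_assoc, mul_assoc]

theorem unitization_inr_smul {R : Type*} [NonUnitalRing R] (a b : R) :
    (a : Unitization ℤ R) • b = a * b := by
  change (a : Unitization ℤ R).fst • b + (a : Unitization ℤ R).snd * b = a * b
  simp

theorem unitization_mul_smul {R : Type*} [NonUnitalRing R] {M : Type*} [AddCommGroup M]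
    [Module (Unitization ℤ R) M] (s t : Unitization ℤ R) (x : M) : (s * t) • x = s • t • x :=
  (LinearMap.toSpanSingleton (Unitization ℤ R) M x).map_smul s t

/-- Finite presentation of a cyclic module gives uniform vanishing on the annihilator of the
generator. -/
theorem eventually_forall_smul_eq_zero {R : Type*} [NonUnitalRing R] {M : Type*} [AddCommGroup M]
    [Module (Unitization ℤ R) M] [Module.FinitePresentation (Unitization ℤ R) M] {x : M}
    (hx : Function.Surjective (LinearMap.toSpanSingleton (Unitization ℤ R) M x)) {v : R}
    (hv : (v : Unitization ℤ R) • x = x) {J : Type*} {l : Filter J} {g : J → R}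
    (hg : ∀ j, v * g j = g j)
    (h : ∀ y : R, (y : Unitization ℤ R) • x = 0 → ∀ᶠ j in l, y * g j = 0) :
    ∀ᶠ j in l, ∀ t : Unitization ℤ R, t • x = 0 → t • g j = 0 := by
  obtain ⟨s, hs⟩ := @Module.FinitePresentation.fg_ker (Unitization ℤ R) (Unitization ℤ R) M _
    Ring.toAddCommGroup _ _ _ _ _ (LinearMap.toSpanSingleton (Unitization ℤ R) M x) hx
  have h1 : ∀ t ∈ s, ∀ᶠ j in l, t • g j = 0 := by
    intro t ht
    have ht0 : t • x = 0 := by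
      have : t ∈ LinearMap.ker (LinearMap.toSpanSingleton (Unitization ℤ R) M x) :=
        hs ▸ Submodule.subset_span ht
      simpa using this
    -- As v fixes both x and g j, the element t of ℤ ⊕ R may be replaced by t v, which lies in R,
    -- where the hypothesis on annihilators applies.
    filter_upwards [h (t • v) (by rw [unitization_smul_inr, unitization_mul_smul, hv, ht0])]
      with j hj
    rw [← hg j, unitization_smul_mul, hj]
  filter_upwards [(Finset.eventually_all s).2 h1] with j hj t ht
  have h2 : t ∈ Submodule.span (Unitization ℤ R) (s : Set (Unitization ℤ R)) := by
    rw [hs]; simpa using ht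
  have h3 : Submodule.span (Unitization ℤ R) (s : Set (Unitization ℤ R)) ≤
      LinearMap.ker (LinearMap.toSpanSingleton (Unitization ℤ R) R (g j)) :=
    Submodule.span_le.2 fun t ht => by simpa using hj t ht
  simpa using h3 h2

namespace BranchingSystem

variable {B : BranchingSystem E}

namespace Degree

theorem surjective_toSpanSingleton (d : B.Degree) (x : B.X) :
    Function.Surjective (LinearMap.toSpanSingleton
    (Unitization ℤ (LeavittPathAlgebra K E)) (B.X →₀ K) (Finsupp.single x 1)) := by
  rw [← LinearMap.range_eq_top]
  exact d.eq_top_of_single_mem _ (x := x) ⟨1, LinearMap.toSpanSingleton_apply_one _ _ _⟩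

/-- The homogeneous components of y move x into different degrees, so their values cannot cancel. -/
theorem rep_proj_eq_zero (d : B.Degree) {y : LeavittPathAlgebra K E} {x : B.X}
    (hy : B.rep K y (Finsupp.single x 1) = 0) (n : ℤ) :
    B.rep K (proj K E n y) (Finsupp.single x 1) = 0 := by
  obtain ⟨s, f, hf, rfl⟩ := exists_eq_sum y
  rw [proj_sum s hf]
  split_ifs with hn
  · have hmem : ∀ m, B.rep K (f m) (Finsupp.single x 1) ∈ d.component K (m + d.deg x) := fun m =>
      d.rep_mem_component (hf m) (d.single_mem_component x 1)
    ext z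
    by_contra hz
    have hdeg := d.mem_component.1 (hmem n) z hz
    have h0 : B.rep K (∑ m ∈ s, f m) (Finsupp.single x 1) z = 0 := by rw [hy]; rfl
    rw [map_sum, LinearMap.sum_apply, Finset.sum_apply', Finset.sum_eq_single_of_mem n hn] at h0
    · exact hz h0
    · intro m _ hm
      by_contra hz'
      exact hm (add_right_cancel ((d.mem_component.1 (hmem m) z hz').symm.trans hdeg))
  · rw [map_zero, LinearMap.zero_apply]

/-- If z ≠ 0, some ghost path carries it to a nonzero multiple of the vertex under x, and that
vertex fixes the basis vector x. -/
theorem rep_ne_zero_of_mem_pathSpan {n : ℤ} {x : B.X} {z : LeavittPathAlgebra K E}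
    (hz : z ∈ pathSpan K E (B.src x) n) (h : B.rep K z (Finsupp.single x 1) = 0) : z = 0 := by
  by_contra h0
  obtain ⟨a, α, k, -, hk, h1⟩ := exists_ghostPath_mul_eq hz h0
  have h2 := rep_smul_vertex (B := B) k x 1
  rw [← h1, map_mul, Module.End.mul_apply, h, map_zero, mul_one] at h2
  exact hk (Finsupp.single_eq_zero.1 h2.symm)

/-- A criterion for an annihilator of `x₀` to annihilate almost all elements of a family `g`. -/
theorem eventually_mul_eq_zero (d : B.Degree) {x₀ : B.X} {J : Type*} {l : Filter J}
    {g h : J → LeavittPathAlgebra K E} {xs : J → B.X} {len : J → ℤ}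
    (H : ∀ a b c α β, E.IsPath a α c → E.IsPath b β c → ∀ᶠ j in l,
      ∃ z ∈ pathSpan K E (B.src (xs j)) ((α.length : ℤ) - β.length + len j),
        path K E a α * ghostPath K E b β * g j = z * h j ∧
        B.rep K (path K E a α * ghostPath K E b β) (Finsupp.single x₀ 1) =
          B.rep K z (Finsupp.single (xs j) 1))
    {y : LeavittPathAlgebra K E} (hy : B.rep K y (Finsupp.single x₀ 1) = 0) :
    ∀ᶠ j in l, y * g j = 0 := by
  -- Homogeneity of y puts the paths from all its monomials into one `pathSpan`. There z is
  -- determined to be 0 by its action on a basis vector, so the annihilators of x₀ are treated one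
  -- homogeneous component at a time.
  have key : ∀ n, ∀ y ∈ LeavittPathAlgebra.component K E n, ∀ᶠ j in l,
      ∃ z ∈ pathSpan K E (B.src (xs j)) (n + len j), y * g j = z * h j ∧
        B.rep K y (Finsupp.single x₀ 1) = B.rep K z (Finsupp.single (xs j) 1) := by
    intro n y hy
    induction hy using Submodule.span_induction with
    | mem y hy =>
      obtain ⟨a, b, c, α, β, hα, hβ, rfl, rfl⟩ := hy
      exact H a b c α β hα hβ
    | zero => exact .of_forall fun j => ⟨0, zero_mem _, by simp, by simp⟩
    | add y y' _ _ ih ih' =>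
      filter_upwards [ih, ih'] with j ⟨z, hz, h1, h2⟩ ⟨z', hz', h1', h2'⟩
      refine ⟨z + z', add_mem hz hz', ?_, ?_⟩
      · rw [add_mul, add_mul, h1, h1']
      · rw [map_add, map_add, LinearMap.add_apply, LinearMap.add_apply, h2, h2']
    | smul k y _ ih =>
      filter_upwards [ih] with j ⟨z, hz, h1, h2⟩
      refine ⟨k • z, Submodule.smul_mem _ _ hz, ?_, ?_⟩
      · rw [smul_mul_assoc, smul_mul_assoc, h1]
      · rw [map_smul, map_smul, LinearMap.smul_apply, LinearMap.smul_apply, h2]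
  obtain ⟨s, hs⟩ := exists_eq_sum_proj y
  have h1 : ∀ n ∈ s, ∀ᶠ j in l, proj K E n y * g j = 0 := by
    intro n _
    filter_upwards [key n _ (proj_mem n y)] with j ⟨z, hz, h1, h2⟩
    rw [d.rep_proj_eq_zero hy n] at h2
    rw [h1, rep_ne_zero_of_mem_pathSpan hz h2.symm, zero_mul]
  filter_upwards [(Finset.eventually_all s).2 h1] with j hj
  rw [hs, Finset.sum_mul]
  exact Finset.sum_eq_zero hj

end Degree

end BranchingSystem

/-! ### Paths ending at a singular vertex -/

namespace DirectedGraph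

variable (E)

theorem IsPath.src_unique {E : DirectedGraph V A} {a a' b : V} {p : List A} (h : E.IsPath a p b)
    (h' : E.IsPath a' p b) : a = a' := by
  cases h with
  | nil => exact (isPath_nil_iff.1 h').symm
  | cons e _ => exact (isPath_cons_iff.1 h').1.symm

/-- The branching system of the paths ending at a vertex that does not emit a nonempty finite set of
edges. -/
def pathSystem (v : V) (hv : ¬ ({e | E.src e = v}.Finite ∧ {e | E.src e = v}.Nonempty)) :
    BranchingSystem E where
  X := {p : V × List A // E.IsPath p.1 p.2 v}
  src x := x.1.1
  cons e x h := ⟨(E.src e, e :: x.1.2), .cons e (h ▸ x.2)⟩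
  src_cons _ _ _ := rfl
  cons_inj e x h f y h' hxy := by
    obtain ⟨⟨a, p⟩, hx⟩ := x
    obtain ⟨⟨b, q⟩, hy⟩ := y
    simp only [Subtype.mk.injEq, Prod.mk.injEq, List.cons.injEq] at hxy h h' ⊢
    obtain ⟨-, rfl, rfl⟩ := hxy
    exact ⟨rfl, h.trans h'.symm, rfl⟩
  exists_cons x hf hn := by
    obtain ⟨⟨a, p⟩, hx⟩ := x
    dsimp only at hx hf hn
    cases hx with
    -- The path of length 0 comes from no edge; this is permitted because v is a sink or an infinite
    -- emitter.
    | nil => exact absurd ⟨hf, hn⟩ hv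
    | cons e hp => exact ⟨e, ⟨(E.tgt e, _), hp⟩, rfl, rfl⟩

variable {E} {v : V} {hv : ¬ ({e | E.src e = v}.Finite ∧ {e | E.src e = v}.Nonempty)}

theorem pathSystem_extends {p : List A} {y x : (E.pathSystem v hv).X}
    (h : (E.pathSystem v hv).Extends p y x) : x.1.2 = p ++ y.1.2 := by
  induction h with
  | nil => rfl
  | cons e _ h ih => exact congrArg (e :: ·) ih

variable (E v hv) in
/-- The path of length `0`. -/
def pathSystemBase : (E.pathSystem v hv).X := ⟨(v, []), .nil v⟩

theorem pathSystem_extends_base (x : (E.pathSystem v hv).X) :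
    (E.pathSystem v hv).Extends x.1.2 (E.pathSystemBase v hv) x := by
  obtain ⟨⟨a, p⟩, hx⟩ := x
  dsimp only at hx ⊢
  induction p generalizing a with
  | nil =>
    obtain rfl := isPath_nil_iff.1 hx
    exact .nil _
  | cons e p ih =>
    obtain ⟨rfl, h⟩ := isPath_cons_iff.1 hx
    exact .cons e (ih _ h) rfl

/-- The length of paths. -/
def pathSystemDegree (v : V) (hv : ¬ ({e | E.src e = v}.Finite ∧ {e | E.src e = v}.Nonempty)) :
    (E.pathSystem v hv).Degree where
  deg x := x.1.2.length
  deg_cons _ _ _ := by simp [pathSystem]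
  connected x y := ⟨_, _, _, pathSystem_extends_base x, pathSystem_extends_base y⟩
  separated x y hxy hd := by
    refine ⟨_, ⟨_, pathSystem_extends_base x⟩, fun z hz => hxy ?_⟩
    have h1 := pathSystem_extends hz
    have h2 : x.1.2 = y.1.2 := by
      have h3 := congrArg List.length h1
      have hd' : x.1.2.length = y.1.2.length := by exact_mod_cast hd
      rw [List.length_append] at h3
      have h4 : z.1.2 = [] := List.length_eq_zero_iff.1 (by omega)
      rw [h1, h4, List.append_nil]
    have h5 : x.1.1 = y.1.1 := x.2.src_unique (h2 ▸ y.2)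
    exact Subtype.ext (Prod.ext h5 h2)

/-! ### Infinite paths tail-equivalent to a given one -/

/-- Put an edge in front of a sequence of edges. -/
def consSeq (e : A) (q : ℕ → A) : ℕ → A
  | 0 => e
  | n + 1 => q n

variable (E)

/-- The branching system of the infinite paths that have a tail in common with `p`, together with
the lag of the common tails. -/
def tailSystem (p : ℕ → A) : BranchingSystem E where
  -- For an eventually periodic p, one sequence of edges has several lags. Recording the lag counts
  -- these as different elements and so provides a degree. The vertex component is redundant, being
  -- the source of the first edge.
  X := {x : V × (ℕ → A) × ℤ // E.IsInfinitePath x.2.1 ∧ x.1 = E.src (x.2.1 0) ∧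
    ∃ i j : ℕ, (∀ t, x.2.1 (i + t) = p (j + t)) ∧ x.2.2 = i - j}
  src x := x.1.1
  cons e x h := ⟨(E.src e, consSeq e x.1.2.1, x.1.2.2 + 1), by
    obtain ⟨⟨a, q, k⟩, hq, ha, i, j, hij, hk⟩ := x
    refine ⟨?_, rfl, i + 1, j, fun t => ?_, ?_⟩
    · rintro (_ | n)
      · exact h.symm.trans ha
      · exact hq n
    · rw [show i + 1 + t = (i + t) + 1 by omega]
      exact hij t
    · dsimp only at hk ⊢
      push_cast
      omega⟩
  src_cons _ _ _ := rfl
  cons_inj e x h f y h' hxy := by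
    obtain ⟨⟨a, q, k⟩, hx⟩ := x
    obtain ⟨⟨b, r, l⟩, hy⟩ := y
    simp only [Subtype.mk.injEq, Prod.mk.injEq] at hxy h h' ⊢
    obtain ⟨-, hqr, hkl⟩ := hxy
    have hef : e = f := congrFun hqr 0
    subst hef
    exact ⟨rfl, h.trans h'.symm, funext fun n => congrFun hqr (n + 1), by omega⟩
  exists_cons x hf hn := by
    obtain ⟨⟨a, q, k⟩, hq, ha, i, j, hij, hk⟩ := x
    dsimp only at ha hk
    refine ⟨q 0, ⟨(E.src (q 1), fun n => q (n + 1), k - 1), fun n => hq (n + 1), rfl, i, j + 1,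
      fun t => ?_, ?_⟩, (hq 0).symm, ?_⟩
    · have := hij (t + 1)
      dsimp only at this ⊢
      rw [show i + t + 1 = i + (t + 1) by omega, this]
      congr 1
      omega
    · dsimp only
      push_cast
      omega
    · refine Subtype.ext (Prod.ext ha (Prod.ext (funext fun n => ?_) ?_))
      · cases n <;> rfl
      · dsimp only
        omega

variable {E} {p : ℕ → A}

/-- Remove the first `m` edges. -/
def tailSystemShift (m : ℕ) (x : (E.tailSystem p).X) : (E.tailSystem p).X :=
  ⟨(E.src (x.1.2.1 m), fun n => x.1.2.1 (m + n), x.1.2.2 - m), by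
    obtain ⟨⟨a, q, k⟩, hq, ha, i, j, hij, hk⟩ := x
    refine ⟨fun n => hq (m + n), rfl, i, j + m, fun t => ?_, ?_⟩
    · have := hij (m + t)
      dsimp only at this ⊢
      rw [show m + (i + t) = i + (m + t) by omega, this]
      congr 1
      omega
    · dsimp only at hk ⊢
      push_cast
      omega⟩

theorem tailSystem_ext {x y : (E.tailSystem p).X} (h : ∀ n, x.1.2.1 n = y.1.2.1 n)
    (hk : x.1.2.2 = y.1.2.2) : x = y := by
  refine Subtype.ext (Prod.ext ?_ (Prod.ext (funext h) hk))
  rw [x.2.2.1, y.2.2.1, h]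

theorem tailSystem_extends_shift (x : (E.tailSystem p).X) (m : ℕ) :
    (E.tailSystem p).Extends (initial x.1.2.1 m) (tailSystemShift m x) x := by
  induction m with
  | zero =>
    have : tailSystemShift 0 x = x := tailSystem_ext (fun n => by simp [tailSystemShift])
      (by simp [tailSystemShift])
    rw [this]
    exact .nil x
  | succ m ih =>
    rw [initial_succ]
    refine ih.append ?_
    have h : (E.tailSystem p).src (tailSystemShift (m + 1) x) = E.tgt (x.1.2.1 m) :=
      (x.2.1 m).symm
    have h2 : (E.tailSystem p).cons (x.1.2.1 m) (tailSystemShift (m + 1) x) h =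
        tailSystemShift m x := by
      refine tailSystem_ext (fun n => ?_) ?_
      · cases n with
        | zero => rfl
        | succ n => exact congrArg x.1.2.1 (by omega : m + 1 + n = m + (n + 1))
      · change x.1.2.2 - ((m + 1 : ℕ) : ℤ) + 1 = x.1.2.2 - m
        push_cast
        ring
    rw [← h2]
    exact .cons _ (.nil _) h

theorem tailSystem_extends {q : List A} {y x : (E.tailSystem p).X}
    (h : (E.tailSystem p).Extends q y x) : q = initial x.1.2.1 q.length := by
  induction h with
  | nil => rfl
  | cons e _ h ih =>
    rw [List.length_cons, initial_succ']
    exact congrArg (e :: ·) ih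

variable (E p) in
/-- The lag. -/
def tailSystemDegree : (E.tailSystem p).Degree where
  deg x := x.1.2.2
  deg_cons _ _ _ := rfl
  connected x y := by
    obtain ⟨-, -, i, j, hij, hk⟩ := x.2
    obtain ⟨-, -, i', j', hij', hk'⟩ := y.2
    -- With these shifts both sequences become p from index j + j' on, with lag −(j + j').
    refine ⟨_, initial y.1.2.1 (i' + j), _, tailSystem_extends_shift x (i + j'), ?_⟩
    have : tailSystemShift (i + j') x = tailSystemShift (i' + j) y := by
      refine tailSystem_ext (fun n => ?_) ?_
      · change x.1.2.1 (i + j' + n) = y.1.2.1 (i' + j + n)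
        rw [add_assoc, hij, add_assoc, hij']
        congr 1
        omega
      · change x.1.2.2 - ((i + j' : ℕ) : ℤ) = y.1.2.2 - ((i' + j : ℕ) : ℤ)
        push_cast
        omega
    rw [this]
    exact tailSystem_extends_shift y (i' + j)
  separated x y hxy hd := by
    obtain ⟨t, ht⟩ : ∃ t, x.1.2.1 t ≠ y.1.2.1 t := by
      by_contra! h
      exact hxy (tailSystem_ext h hd)
    refine ⟨_, ⟨_, tailSystem_extends_shift x (t + 1)⟩, fun z hz => ht ?_⟩
    have h := tailSystem_extends hz
    rw [length_initial, initial_succ, initial_succ] at h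
    exact List.singleton_injective (List.append_inj_right' h rfl)

variable (E p) in
/-- The infinite path `p` itself. -/
def tailSystemBase (hp : E.IsInfinitePath p) : (E.tailSystem p).X :=
  ⟨(E.src (p 0), p, 0), hp, rfl, 0, 0, fun _ => rfl, by simp⟩

end DirectedGraph

/-! ### Vertices and ghost edges are nonzero. -/

namespace LeavittPathAlgebra

/-- Some branching system has an element over a: a path to a sink or infinite emitter if the tree of
a contains one; otherwise every vertex of the tree emits an edge, and there is an infinite path from
a. -/
theorem vertex_ne_zero (a : V) : vertex K E a ≠ 0 := by
  by_cases h : ∃ b ∈ E.tree a, ¬ ({e | E.src e = b}.Finite ∧ {e | E.src e = b}.Nonempty)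
  · obtain ⟨b, ⟨p, hp⟩, hb⟩ := h
    exact BranchingSystem.vertex_ne_zero_of_src (B := E.pathSystem b hb) ⟨(a, p), hp⟩
  · push Not at h
    obtain ⟨p, hp, rfl, -⟩ := exists_isInfinitePath (E := E) (P := (· ∈ E.tree a)) (fun b hb => by
      obtain ⟨e, he⟩ := (h b hb).2
      exact ⟨e, he, tree_trans hb (he ▸ E.tgt_mem_tree e)⟩) (E.mem_tree_self a)
    exact BranchingSystem.vertex_ne_zero_of_src (B := E.tailSystem p) (E.tailSystemBase p hp)

theorem ghost_ne_zero (e : A) : ghost K E e ≠ 0 := fun h => by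
  have := (isLeavittFamily (K := K) (E := E)).ck1_same e
  rw [h, zero_mul] at this
  exact vertex_ne_zero _ this.symm

end LeavittPathAlgebra

end

/-! ### Modules that are not finitely presented: (1) implies (3). -/

section

open DirectedGraph LeavittPathAlgebra Filter

variable {V : Type u} {A : Type v} {E : DirectedGraph V A} {K : Type w} [Field K]

namespace LeavittPathAlgebra

theorem mul_vertex_of_mem_pathSpan {c : V} {n : ℤ} {z : LeavittPathAlgebra K E}
    (hz : z ∈ pathSpan K E c n) : z * vertex K E c = z := by
  induction hz using Submodule.span_induction with
  | mem z hz =>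
    obtain ⟨a, α, hα, -, rfl⟩ := hz
    exact path_mul_vertex hα
  | zero => rw [zero_mul]
  | add x y _ _ hx hy => rw [add_mul, hx, hy]
  | smul k x _ hx => rw [smul_mul_assoc, hx]

theorem path_mem_pathSpan {a c : V} {α : List A} (hα : E.IsPath a α c) :
    path K E a α ∈ pathSpan K E c α.length :=
  Submodule.subset_span ⟨a, α, hα, rfl, rfl⟩

/-- A monomial `α β*` times a path `γ` with `|β| ≤ |γ|` is zero or a path. -/
theorem monomial_mul_path_mem {a b c a' c' : V} {α β γ : List A} (hα : E.IsPath a α c)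
    (hβ : E.IsPath b β c) (hγ : E.IsPath a' γ c') (hl : β.length ≤ γ.length) :
    path K E a α * ghostPath K E b β * path K E a' γ ∈
      pathSpan K E c' ((α.length : ℤ) - β.length + γ.length) := by
  rw [mul_assoc]
  by_cases h : b = a' ∧ β <+: γ
  · obtain ⟨rfl, τ, rfl⟩ := h
    obtain ⟨d, h1, h2⟩ := isPath_append_iff.1 hγ
    obtain rfl := hβ.tgt_unique h1
    rw [ghostPath_mul_path_append hβ h2, path_mul_path hα h2]
    have := path_mem_pathSpan (K := K) (hα.append h2)
    have hlen : (α.length : ℤ) - β.length + (β ++ τ).length = (α ++ τ).length := by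
      push_cast [List.length_append]
      ring
    rwa [hlen]
  · rw [ghostPath_mul_path_eq_zero hβ hγ hl fun h1 h2 => h ⟨h1, h2⟩, mul_zero]
    exact zero_mem _

end LeavittPathAlgebra

namespace DirectedGraph

/-- The module of the paths ending at an infinite emitter is not finitely presented. -/
theorem not_finitePresentation_pathSystem {v : V} (hv : ¬ {e | E.src e = v}.Finite) :
    ¬ Module.FinitePresentation (Unitization ℤ (LeavittPathAlgebra K E))
      ((E.pathSystem v fun h => hv h.1).X →₀ K) := by
  intro hfp
  set B := E.pathSystem v fun h => hv h.1 with hB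
  set x₀ : B.X := E.pathSystemBase v fun h => hv h.1 with hx₀
  have hinf : Infinite {e // E.src e = v} := Set.infinite_coe_iff.2 hv
  have d : B.Degree := E.pathSystemDegree v fun h => hv h.1
  have hsrc : B.src x₀ = v := rfl
  have hghost : ∀ e, B.rep K (ghost K E e) (Finsupp.single x₀ 1) = 0 := fun e => by
    rw [B.rep_ghost, B.ghostEnd_of_ne]
    intro y h hxy
    exact List.cons_ne_nil _ _ (congrArg (fun x : B.X => x.1.2) hxy).symm
  -- The test family consists of the edges emitted by v, with the cofinite filter. The conclusion
  -- for e* would give e* e = 0, that is r(e) = 0.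
  have key := eventually_forall_smul_eq_zero (l := cofinite) (v := vertex K E v)
    (g := fun e : {e // E.src e = v} => edge K E e.1)
    (d.surjective_toSpanSingleton (K := K) x₀)
    (by rw [BranchingSystem.inr_smul, B.rep_vertex, B.vertexEnd_of_eq K hsrc])
    (by rintro ⟨e, rfl⟩; exact isLeavittFamily.src_edge e) ?_
  · obtain ⟨e, he⟩ := key.exists
    have h1 := he (ghost K E e.1) (by rw [BranchingSystem.inr_smul, hghost])
    rw [unitization_inr_smul, isLeavittFamily.ck1_same] at h1
    exact vertex_ne_zero _ h1
  · intro y hy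
    rw [BranchingSystem.inr_smul] at hy
    refine d.eventually_mul_eq_zero (h := fun e : {e // E.src e = v} => edge K E e.1)
      (xs := fun _ => x₀) (len := fun _ => 0) ?_ hy
    intro a b c α β hα hβ
    cases hβ with
    | nil =>
      rw [ghostPath, path_mul_vertex hα]
      by_cases hc : b = v
      · subst hc
        refine .of_forall fun e => ⟨path K E a α, ?_, rfl, rfl⟩
        simpa [hsrc] using path_mem_pathSpan (K := K) hα
      · refine .of_forall fun e => ⟨0, zero_mem _, ?_, ?_⟩
        · rw [← path_mul_vertex hα, mul_assoc, ← isLeavittFamily.src_edge e.1,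
            ← mul_assoc (vertex K E b), vertex_mul_of_ne (fun h => hc (h.trans e.2)), zero_mul, mul_zero,
              zero_mul]
        · rw [← path_mul_vertex hα, map_mul, Module.End.mul_apply, B.rep_vertex,
            B.vertexEnd_of_ne K (fun h => hc (h.symm.trans hsrc))]
          simp
    | @cons f β _ hβ =>
      rw [ghostPath]
      -- The ghost path β* ends in f* on the right, which kills x₀ and every emitted edge except
      -- possibly f itself.
      have hf : ∀ᶠ e : {e // E.src e = v} in cofinite, f ≠ e.1 := by
        refine (Set.Finite.subset ((Set.finite_singleton f).preimage
          Subtype.val_injective.injOn) ?_)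
        intro e he
        exact (not_not.1 he).symm
      filter_upwards [hf] with e he
      refine ⟨0, zero_mem _, ?_, ?_⟩
      · rw [mul_assoc, mul_assoc, isLeavittFamily.ck1_ne _ _ he, mul_zero, mul_zero, zero_mul]
      · rw [map_mul, map_mul, Module.End.mul_apply, Module.End.mul_apply, hghost]
        simp

/-- The module of an infinite path with infinitely many bifurcations is not finitely presented. -/
theorem not_finitePresentation_tailSystem {p : ℕ → A} (hp : E.IsInfinitePath p)
    (hbif : ∀ m : ℕ, ∃ n, m ≤ n ∧ E.IsBifurcation (E.src (p n))) :
    ¬ Module.FinitePresentation (Unitization ℤ (LeavittPathAlgebra K E))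
      ((E.tailSystem p).X →₀ K) := by
  intro hfp
  set B := E.tailSystem p with hB
  set x₀ : B.X := E.tailSystemBase p hp with hx₀
  have d : B.Degree := E.tailSystemDegree p
  have hsrc : B.src x₀ = E.src (p 0) := rfl
  have hext : ∀ m, B.Extends (initial p m) (tailSystemShift m x₀) x₀ :=
    fun m => tailSystem_extends_shift x₀ m
  have hsrc' : ∀ m, B.src (tailSystemShift m x₀) = E.src (p m) := fun _ => rfl
  -- The test family consists of the initial segments of p, with length tending to infinity.
  have key := eventually_forall_smul_eq_zero (l := atTop) (v := vertex K E (E.src (p 0)))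
    (g := fun m : ℕ => path K E (E.src (p 0)) (initial p m))
    (d.surjective_toSpanSingleton (K := K) x₀)
    (by rw [BranchingSystem.inr_smul, B.rep_vertex, B.vertexEnd_of_eq K hsrc])
    (fun m => vertex_mul_path (hp.isPath m)) ?_
  · obtain ⟨N, hN⟩ := eventually_atTop.1 key
    obtain ⟨m, hm, e, e', hne, he, he'⟩ := hbif N
    obtain ⟨f, hf, hfp⟩ : ∃ f, E.src f = E.src (p m) ∧ f ≠ p m := by
      by_cases h : e = p m
      · exact ⟨e', he', fun h' => hne (h.trans h'.symm)⟩
      · exact ⟨e, he, h⟩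
    have hpath : E.IsPath (E.src (p m)) [f] (E.tgt f) := hf ▸ .cons f (.nil _)
    -- The ghost of the path that follows p for m edges and then leaves along f kills x₀, but sends
    -- the m-th initial segment to f* ≠ 0.
    have h1 := hN m hm (ghostPath K E (E.src (p 0)) (initial p m ++ [f])) ?_
    · rw [unitization_inr_smul, ← ghostPath_mul_ghostPath (hp.isPath m) hpath, mul_assoc,
        ghostPath_mul_path_self (hp.isPath m), ghostPath_mul_vertex hpath,
        ghostPath_singleton] at h1
      exact ghost_ne_zero f h1
    · rw [BranchingSystem.inr_smul]
      rcases BranchingSystem.rep_ghostPath_eq_zero_or (K := K) ((hp.isPath m).append hpath) x₀ with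
        h | ⟨y, hy, -⟩
      · exact h
      · have h2 := tailSystem_extends hy
        rw [List.length_append, length_initial, List.length_singleton, initial_succ] at h2
        exact absurd (List.singleton_injective (List.append_inj_right' h2 rfl)) hfp
  · intro y hy
    rw [BranchingSystem.inr_smul] at hy
    -- The m-th initial segment extends the m-th tail to x₀. Once m ≥ |β|, its product with α β* is
    -- zero or a path, and this product serves as z.
    refine d.eventually_mul_eq_zero (h := fun m => vertex K E (E.src (p m)))
      (xs := fun m => tailSystemShift m x₀) (len := fun m => m) ?_ hy
    intro a b c α β hα hβ
    filter_upwards [eventually_ge_atTop β.length] with m hm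
    have hmem := monomial_mul_path_mem (K := K) hα hβ (hp.isPath m)
      (by rwa [length_initial])
    rw [length_initial] at hmem
    refine ⟨_, hmem, (mul_vertex_of_mem_pathSpan hmem).symm, ?_⟩
    have h3 := BranchingSystem.rep_path_of_extends (K := K) (hext m)
    rw [map_mul _ (path K E a α * ghostPath K E b β), Module.End.mul_apply]
    rw [hsrc] at h3
    rw [h3]

/-- If the graded-simple modules are finitely presented, then the graph is row-finite and long paths
end at vertices whose tree contains no bifurcation. -/
theorem rowFinite_and_unbranched_of_finitePresentation
    (h : ∀ (M : Type (max u v w)) [AddCommGroup M]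
        [Module (Unitization ℤ (LeavittPathAlgebra K E)) M] (ℳ : ℤ → AddSubgroup M),
        IsGradedSimple (LeavittPathAlgebra.grading K E) ℳ →
          Module.FinitePresentation (Unitization ℤ (LeavittPathAlgebra K E)) M) :
    E.RowFinite ∧ ∀ a : V, ∃ n : ℕ, ∀ (p : List A) (b : V), E.IsPath a p b → n ≤ p.length →
      E.Unbranched b := by
  have hE : E.RowFinite := by
    intro v
    by_contra hv
    have : Nonempty (E.pathSystem v fun h => hv h.1).X := ⟨E.pathSystemBase v fun h => hv h.1⟩
    exact not_finitePresentation_pathSystem hv (h _ _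
      (E.pathSystemDegree v fun h => hv h.1).isGradedSimple)
  refine ⟨hE, fun a => ?_⟩
  by_contra! ha
  obtain ⟨p, hp, hbif⟩ := hE.exists_isInfinitePath ha
  have : Nonempty (E.tailSystem p).X := ⟨E.tailSystemBase p hp⟩
  exact not_finitePresentation_tailSystem hp hbif (h _ _ (E.tailSystemDegree p).isGradedSimple)

end DirectedGraph

end

/-! ### Graded semisimplicity: (3) implies (2), and (2) implies (1). -/

section

open DirectedGraph LeavittPathAlgebra

variable {K : Type w} [Field K] {V : Type u} {A : Type v} {E : DirectedGraph V A}

namespace LeavittPathAlgebra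

theorem mul_mem_component {m n : ℤ} {x y : LeavittPathAlgebra K E} (hx : x ∈ component K E m)
    (hy : y ∈ component K E n) : x * y ∈ component K E (m + n) := by
  have h : proj K E (m + n) (x * y) = x * y := by
    simp [proj, coaction_of_mem hx, coaction_of_mem hy, homogeneous,
      AddMonoidAlgebra.coeff_single, -LaurentPolynomial.single_eq_C_mul_T]
  exact h ▸ proj_mem _ _

theorem proj_mul {n : ℤ} {y : LeavittPathAlgebra K E} (hy : y ∈ component K E 0)
    (x : LeavittPathAlgebra K E) : proj K E n (x * y) = proj K E n x * y := by
  obtain ⟨s, f, hf, rfl⟩ := exists_eq_sum x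
  rw [proj_sum s hf, Finset.sum_mul, proj_sum s (f := fun m => f m * y)]
  · rw [ite_mul, zero_mul]
  · intro m
    simpa using mul_mem_component (hf m) hy

/-- A property of the elements of `L` that is additive and holds for all `y v` holds for all
elements. -/
theorem induction_mul_vertex {P : LeavittPathAlgebra K E → Prop} (zero : P 0)
    (add : ∀ x y, P x → P y → P (x + y)) (mul_vertex : ∀ y a, P (y * vertex K E a))
    (x : LeavittPathAlgebra K E) : P x := by
  have hx : x ∈ Submodule.span K (monomials K E) := by
    rw [span_monomials]; exact Submodule.mem_top
  suffices ∀ k : K, P (k • x) by simpa using this 1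
  induction hx using Submodule.span_induction with
  | mem x hx =>
    intro k
    obtain ⟨a, b, c, α, β, hα, hβ, rfl⟩ := hx
    rw [← ghostPath_mul_vertex hβ, ← mul_assoc, ← smul_mul_assoc]
    exact mul_vertex _ _
  | zero => intro k; rwa [smul_zero]
  | add x y _ _ hx hy => intro k; rw [smul_add]; exact add _ _ (hx k) (hy k)
  | smul k x _ hx => intro k'; rw [smul_smul]; exact hx _

/-! ### Graded left ideals as submodules over a ring of operators -/

variable (K E) in
/-- The ring of operators on `L` generated by the left multiplications and the projections onto the
homogeneous components. Its submodules are the graded left ideals. -/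
noncomputable def gradedOperators : Subalgebra ℤ (Module.End ℤ (LeavittPathAlgebra K E)) :=
  Algebra.adjoin ℤ (Set.range (fun a : LeavittPathAlgebra K E =>
    (AddMonoidHom.mulLeft a).toIntLinearMap) ∪ Set.range fun n => (proj K E n).toIntLinearMap)

theorem mul_mem_of_gradedOperators
    (J : Submodule (gradedOperators K E) (LeavittPathAlgebra K E))
    (a : LeavittPathAlgebra K E) {x : LeavittPathAlgebra K E} (hx : x ∈ J) : a * x ∈ J :=
  J.smul_mem ⟨_, Algebra.subset_adjoin (.inl ⟨a, rfl⟩)⟩ hx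

theorem proj_mem_of_gradedOperators
    (J : Submodule (gradedOperators K E) (LeavittPathAlgebra K E))
    (n : ℤ) {x : LeavittPathAlgebra K E} (hx : x ∈ J) : proj K E n x ∈ J :=
  J.smul_mem ⟨_, Algebra.subset_adjoin (.inr ⟨n, rfl⟩)⟩ hx

/-- An additive subgroup closed under left multiplications and projections as a submodule over the
ring of operators. -/
noncomputable def gradedSubmodule (S : AddSubgroup (LeavittPathAlgebra K E))
    (hmul : ∀ a, ∀ x ∈ S, a * x ∈ S) (hproj : ∀ n, ∀ x ∈ S, proj K E n x ∈ S) :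
    Submodule (gradedOperators K E) (LeavittPathAlgebra K E) where
  __ := S
  smul_mem' := by
    rintro ⟨r, hr⟩ x hx
    change r x ∈ S
    change x ∈ S at hx
    revert x
    induction hr using Algebra.adjoin_induction with
    | mem r hr =>
      intro x hx
      rcases hr with ⟨a, rfl⟩ | ⟨n, rfl⟩
      · exact hmul a x hx
      · exact hproj n x hx
    | algebraMap n => intro x hx; exact S.zsmul_mem hx n
    | add r s _ _ hr hs => intro x hx; exact S.add_mem (hr hx) (hs hx)
    | mul r s _ _ hr hs => intro x hx; exact hr (hs hx)

theorem _root_.unitization_neg_mem {R : Type*} [NonUnitalRing R] {M : Type*} [AddCommGroup M]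
    [Module (Unitization ℤ R) M] (N : Submodule (Unitization ℤ R) M) {x : M} (hx : x ∈ N) :
    -x ∈ N :=
  @Submodule.neg_mem (Unitization ℤ R) M Unitization.instRing _ _ N x hx

/-- The left ideal underlying a submodule over the ring of operators. -/
noncomputable def toLeftIdeal (J : Submodule (gradedOperators K E) (LeavittPathAlgebra K E)) :
    Submodule (Unitization ℤ (LeavittPathAlgebra K E)) (LeavittPathAlgebra K E) where
  __ := J.toAddSubgroup
  smul_mem' t _ hx := J.add_mem (J.toAddSubgroup.zsmul_mem hx t.fst)
    (mul_mem_of_gradedOperators J t.snd hx)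

theorem toLeftIdeal_injective : Function.Injective (toLeftIdeal (K := K) (E := E)) :=
  fun _ _ h => SetLike.ext fun x => SetLike.ext_iff.1 h x

theorem isGradedSubmodule_toLeftIdeal
    (J : Submodule (gradedOperators K E) (LeavittPathAlgebra K E)) :
    IsGradedSubmodule (grading K E) (toLeftIdeal J) := by
  intro x hx
  obtain ⟨s, hs⟩ := exists_eq_sum_proj x
  rw [hs]
  exact sum_mem fun n _ => AddSubgroup.subset_closure
    ⟨proj_mem_of_gradedOperators J n hx, n, proj_mem n x⟩

theorem proj_mem_of_isGradedSubmodule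
    {N : Submodule (Unitization ℤ (LeavittPathAlgebra K E)) (LeavittPathAlgebra K E)}
    (hN : IsGradedSubmodule (grading K E) N) (n : ℤ) {x : LeavittPathAlgebra K E} (hx : x ∈ N) :
    proj K E n x ∈ N := by
  have hcl := hN x hx
  clear hx
  induction hcl using AddSubgroup.closure_induction with
  | mem x hx =>
    obtain ⟨hx, m, hm⟩ := hx
    by_cases h : m = n
    · subst h
      rwa [proj_of_mem hm]
    · rw [proj_of_mem_of_ne h hm]
      exact zero_mem _
  | zero => rw [map_zero]; exact zero_mem _
  | add x y _ _ hx hy => rw [map_add]; exact add_mem hx hy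
  | neg x _ hx => rw [map_neg]; exact unitization_neg_mem N hx

theorem exists_toLeftIdeal_eq
    {N : Submodule (Unitization ℤ (LeavittPathAlgebra K E)) (LeavittPathAlgebra K E)}
    (hN : IsGradedSubmodule (grading K E) N) : ∃ J, toLeftIdeal J = N :=
  ⟨gradedSubmodule { N.toAddSubmonoid with neg_mem' := unitization_neg_mem N }
    (fun a x (hx : x ∈ N) => by
      have := N.smul_mem (a : Unitization ℤ (LeavittPathAlgebra K E)) hx
      rwa [unitization_inr_smul] at this)
    fun n _ (hx : _ ∈ N) => proj_mem_of_isGradedSubmodule hN n hx, rfl⟩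

theorem toLeftIdeal_le {J J' : Submodule (gradedOperators K E) (LeavittPathAlgebra K E)} :
    toLeftIdeal J ≤ toLeftIdeal J' ↔ J ≤ J' := Iff.rfl

theorem toLeftIdeal_bot : toLeftIdeal (⊥ : Submodule (gradedOperators K E) _) = ⊥ :=
  SetLike.ext fun _ => Iff.rfl

theorem toLeftIdeal_top : toLeftIdeal (⊤ : Submodule (gradedOperators K E) _) = ⊤ :=
  SetLike.ext fun _ => Iff.rfl

theorem isMinimalGradedLeftIdeal_toLeftIdeal
    {J : Submodule (gradedOperators K E) (LeavittPathAlgebra K E)} :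
    IsMinimalGradedLeftIdeal (grading K E) (toLeftIdeal J) ↔ IsAtom J := by
  rw [isAtom_iff_le_of_ge, IsMinimalGradedLeftIdeal, ← toLeftIdeal_bot,
    toLeftIdeal_injective.ne_iff]
  constructor
  · rintro ⟨-, h0, h⟩
    refine ⟨h0, fun J' hJ' hle => ?_⟩
    rcases h _ (isGradedSubmodule_toLeftIdeal J') hle with h | h
    · exact absurd (toLeftIdeal_injective h) hJ'
    · exact (toLeftIdeal_injective h).ge
  · rintro ⟨h0, h⟩
    refine ⟨isGradedSubmodule_toLeftIdeal J, h0, fun N hN hle => ?_⟩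
    obtain ⟨J', rfl⟩ := exists_toLeftIdeal_eq hN
    by_cases h' : J' = ⊥
    · exact .inl (by rw [h'])
    · exact .inr (hle.antisymm (h J' h' hle))

/-- A sum of graded left ideals is graded, so suprema agree in the two lattices. -/
theorem sSup_image_toLeftIdeal
    (s : Set (Submodule (gradedOperators K E) (LeavittPathAlgebra K E))) :
    sSup (toLeftIdeal '' s) = toLeftIdeal (sSup s) := by
  refine le_antisymm (sSup_le ?_) ?_
  · rintro _ ⟨J, hJ, rfl⟩
    exact le_sSup hJ
  · have hgr : IsGradedSubmodule (grading K E) (sSup (toLeftIdeal '' s)) := by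
      intro x hx
      have hx' := hx
      clear hx
      rw [sSup_eq_iSup'] at hx'
      induction hx' using Submodule.iSup_induction' with
      | mem i x hx' =>
        obtain ⟨_, J, hJ, rfl⟩ := i
        have hle : toLeftIdeal J ≤ sSup (toLeftIdeal '' s) := le_sSup (Set.mem_image_of_mem _ hJ)
        exact AddSubgroup.closure_mono (fun y hy => And.intro (hle hy.1) hy.2)
          (isGradedSubmodule_toLeftIdeal J x hx')
      | zero => exact zero_mem _
      | add x y _ _ hx hy => exact add_mem hx hy
    obtain ⟨T, hT⟩ := exists_toLeftIdeal_eq hgr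
    rw [← hT, toLeftIdeal_le]
    refine sSup_le fun J hJ => ?_
    rw [← toLeftIdeal_le, hT]
    exact le_sSup ⟨J, hJ, rfl⟩

/-- Minimal graded left ideals are the atoms of a lattice of submodules. In such a lattice, if the
atoms have supremum ⊤, then some independent set of atoms already does. -/
theorem isGradedSemisimpleRing_iff :
    IsGradedSemisimpleRing (grading K E) ↔
      sSup {J : Submodule (gradedOperators K E) (LeavittPathAlgebra K E) | IsAtom J} = ⊤ := by
  constructor
  · rintro ⟨S, hS, -, htop⟩
    rw [← toLeftIdeal_injective.eq_iff, toLeftIdeal_top, eq_top_iff, ← htop]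
    refine sSup_le fun I hI => ?_
    obtain ⟨J, rfl⟩ := exists_toLeftIdeal_eq (hS I hI).1
    exact toLeftIdeal_le.2 (le_sSup (isMinimalGradedLeftIdeal_toLeftIdeal.1 (hS _ hI)))
  · intro h
    obtain ⟨s, hind, htop, hs⟩ := exists_sSupIndep_of_sSup_atoms_eq_top h
    refine ⟨toLeftIdeal '' s, ?_, ?_, ?_⟩
    · rintro _ ⟨J, hJ, rfl⟩
      exact isMinimalGradedLeftIdeal_toLeftIdeal.2 (hs hJ)
    · rintro _ ⟨J, hJ, rfl⟩
      have hle : sSup (toLeftIdeal '' s \ {toLeftIdeal J}) ≤ toLeftIdeal (sSup (s \ {J})) := by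
        rw [← sSup_image_toLeftIdeal]
        refine sSup_le_sSup ?_
        rintro _ ⟨⟨J', hJ', rfl⟩, hne⟩
        exact ⟨J', ⟨hJ', fun h' => hne (congrArg toLeftIdeal h')⟩, rfl⟩
      refine Disjoint.mono_right hle (Submodule.disjoint_def.2 fun x hx hx' => ?_)
      exact Submodule.disjoint_def.1 (hind hJ) x hx hx'
    · rw [sSup_image_toLeftIdeal, htop, toLeftIdeal_top]

/-! ### Minimal graded left ideals from vertices whose tree contains no bifurcation -/

/-- At a vertex emitting exactly one edge e, the last defining relation reads v = e e*. -/
theorem path_mul_ghostPath_of_unbranched {a c : V} {p : List A} (ha : E.Unbranched a)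
    (hp : E.IsPath a p c) : path K E a p * ghostPath K E a p = vertex K E a := by
  induction hp with
  | nil a => exact vertex_mul_self a
  | cons e hp ih =>
    have hset : {f | E.src f = E.src e} = {e} := by
      ext f
      exact ⟨fun hf => eq_of_not_isBifurcation (ha _ (E.mem_tree_self _)) hf rfl,
        fun hf => congrArg E.src hf⟩
    have hfin : {f | E.src f = E.src e}.Finite := hset ▸ Set.finite_singleton e
    have htf : hfin.toFinset = {e} := by
      rw [← Finset.coe_inj, Set.Finite.coe_toFinset, hset, Finset.coe_singleton]
    rw [isLeavittFamily.ck2 _ hfin ⟨e, rfl⟩, htf, Finset.sum_singleton, path, ghostPath, mul_assoc,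
      ← mul_assoc (path K E _ _), ih (ha.of_mem_tree (E.tgt_mem_tree e)),
      isLeavittFamily.tgt_ghost]

theorem pathSpan_mul_path {c c' : V} {n : ℤ} {z : LeavittPathAlgebra K E} {p : List A}
    (hz : z ∈ pathSpan K E c n) (hp : E.IsPath c p c') :
    z * path K E c p ∈ pathSpan K E c' (n + p.length) := by
  induction hz using Submodule.span_induction with
  | mem z hz =>
    obtain ⟨a, α, hα, rfl, rfl⟩ := hz
    rw [path_mul_path hα hp, ← Nat.cast_add, ← List.length_append]
    exact path_mem_pathSpan (hα.append hp)
  | zero => rw [zero_mul]; exact zero_mem _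
  | add x y _ _ hx hy => rw [add_mul]; exact add_mem hx hy
  | smul k x _ hx => rw [smul_mul_assoc]; exact Submodule.smul_mem _ _ hx

/-- The paths from a are comparable, so the longest β among the monomials α β* of x with β starting
at a extends all the others; right multiplication by it removes every ghost part. Monomials with β
starting elsewhere are killed. -/
theorem exists_mul_path_mem_pathSpan {a : V} (ha : E.Unbranched a) {n : ℤ}
    {x : LeavittPathAlgebra K E} (hx : x ∈ component K E n) :
    ∃ p c, E.IsPath a p c ∧ x * path K E a p ∈ pathSpan K E c (n + p.length) := by
  induction hx using Submodule.span_induction with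
  | mem x hx =>
    obtain ⟨a', b, c, α, β, hα, hβ, rfl, rfl⟩ := hx
    by_cases h : b = a
    · subst h
      refine ⟨β, c, hβ, ?_⟩
      rw [mul_assoc, ghostPath_mul_path_self hβ, path_mul_vertex hα, sub_add_cancel]
      exact path_mem_pathSpan hα
    · refine ⟨[], a, .nil a, ?_⟩
      rw [path, mul_assoc, ← ghostPath_mul_vertex hβ, mul_assoc (ghostPath K E b β),
        vertex_mul_of_ne h, mul_zero, mul_zero]
      exact zero_mem _
  | zero => exact ⟨[], a, .nil a, by rw [zero_mul]; exact zero_mem _⟩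
  | add x y _ _ hx hy =>
    have key : ∀ {x y : LeavittPathAlgebra K E} {p q : List A} {c d : V}, E.IsPath a p c →
        E.IsPath a q d → p.length ≤ q.length → x * path K E a p ∈ pathSpan K E c (n + p.length) →
        y * path K E a q ∈ pathSpan K E d (n + q.length) →
        x * path K E a q + y * path K E a q ∈ pathSpan K E d (n + q.length) := by
      intro x y p q c d hp hq hl hx hy
      obtain ⟨τ, rfl⟩ := ha.prefix_of_length_le hp hq hl
      obtain ⟨c', h1, h2⟩ := isPath_append_iff.1 hq
      obtain rfl := hp.tgt_unique h1
      refine add_mem ?_ hy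
      have := pathSpan_mul_path hx h2
      rw [mul_assoc, path_mul_path hp h2] at this
      rw [List.length_append]
      push_cast
      rwa [← add_assoc]
    obtain ⟨p, c, hp, hx⟩ := hx
    obtain ⟨q, d, hq, hy⟩ := hy
    rcases le_total p.length q.length with hl | hl
    · exact ⟨q, d, hq, by rw [add_mul]; exact key hp hq hl hx hy⟩
    · exact ⟨p, c, hp, by rw [add_mul, add_comm (x * _)]; exact key hq hp hl hy hx⟩
  | smul k x _ hx =>
    obtain ⟨p, c, hp, hx⟩ := hx
    exact ⟨p, c, hp, by rw [smul_mul_assoc]; exact Submodule.smul_mem _ _ hx⟩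

/-- Each nonzero homogeneous element of `L a` generates `L a`. -/
theorem exists_mul_eq_vertex {a : V} (ha : E.Unbranched a) {n : ℤ} {x : LeavittPathAlgebra K E}
    (hx : x ∈ component K E n) (hxa : x * vertex K E a = x) (h0 : x ≠ 0) :
    ∃ z, z * x = vertex K E a := by
  obtain ⟨p, c, hp, hxp⟩ := exists_mul_path_mem_pathSpan ha hx
  have hpp := path_mul_ghostPath_of_unbranched (K := K) ha hp
  have hx' : x = x * path K E a p * ghostPath K E a p := by rw [mul_assoc, hpp, hxa]
  obtain ⟨b, α, k, hα, hk, h⟩ := exists_ghostPath_mul_eq hxp fun h => h0 (by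
    rw [hx', h, zero_mul])
  -- As p p* = a, multiplication by p loses nothing: α* carries x p to k c, and p on the left and p*
  -- on the right turn c back into a.
  refine ⟨k⁻¹ • (path K E a p * ghostPath K E b α), ?_⟩
  rw [hx', smul_mul_assoc, mul_assoc (path K E a p), ← mul_assoc (ghostPath K E b α), h,
    smul_mul_assoc, vertex_mul_ghostPath hp, mul_smul_comm, smul_smul, inv_mul_cancel₀ hk, one_smul,
    hpp]

/-- The left ideal `L α*` is a minimal graded left ideal if `α` ends at a vertex whose tree contains
no bifurcation. -/
theorem isAtom_span_ghostPath {a c : V} {α : List A} (hα : E.IsPath a α c) (hc : E.Unbranched c) :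
    IsAtom (Submodule.span (gradedOperators K E) {ghostPath K E a α}) := by
  -- Right multiplication by α α* fixes α*. It commutes with left multiplications and, being of
  -- degree 0, with the projections; so it fixes the whole ideal. Hence right multiplication by α is
  -- injective on the ideal.
  have hinv : ∀ x ∈ Submodule.span (gradedOperators K E) {ghostPath K E a α},
      x * (path K E a α * ghostPath K E a α) = x := by
    have h0 : path K E a α * ghostPath K E a α ∈ component K E 0 := by
      simpa using monomial_mem_component (K := K) hα hα
    let S : AddSubgroup (LeavittPathAlgebra K E) :=
      { carrier := {x | x * (path K E a α * ghostPath K E a α) = x}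
        zero_mem' := zero_mul _
        add_mem' := fun {x y} (hx : _ = _) (hy : _ = _) =>
          show (x + y) * _ = x + y by rw [add_mul, hx, hy]
        neg_mem' := fun {x} (hx : _ = _) => show -x * _ = -x by rw [neg_mul, hx] }
    have hle : Submodule.span (gradedOperators K E) {ghostPath K E a α} ≤
        gradedSubmodule S
          (fun a x (hx : _ = _) => show a * x * _ = a * x by rw [mul_assoc, hx])
          (fun n x (hx : _ = _) => show proj K E n x * _ = proj K E n x by
            rw [← proj_mul h0, hx]) := by
      rw [Submodule.span_singleton_le_iff_mem]
      change ghostPath K E a α * _ = ghostPath K E a α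
      rw [← mul_assoc, ghostPath_mul_path_self hα, vertex_mul_ghostPath hα]
    exact hle
  rw [isAtom_iff_le_of_ge]
  refine ⟨?_, fun J hJ hle => ?_⟩
  · rw [Ne, Submodule.span_singleton_eq_bot]
    intro h
    have h1 := ghostPath_mul_path_self (K := K) hα
    rw [h, zero_mul] at h1
    exact vertex_ne_zero c h1.symm
  · obtain ⟨y, hy, hy0⟩ := J.ne_bot_iff.1 hJ
    obtain ⟨s, hs⟩ := exists_eq_sum_proj y
    obtain ⟨n, hn⟩ : ∃ n, proj K E n y ≠ 0 := by
      by_contra! h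
      exact hy0 (by rw [hs, Finset.sum_eq_zero fun n _ => h n])
    set x := proj K E n y with hx
    have hxJ : x ∈ J := proj_mem_of_gradedOperators J n hy
    have hxα := hinv x (hle hxJ)
    rw [← mul_assoc] at hxα
    -- The element x α is homogeneous and nonzero in L c, so some z gives z x α = c, whence z x =
    -- α*.
    obtain ⟨z, hz⟩ := exists_mul_eq_vertex (x := x * path K E a α) hc
      (mul_mem_component (proj_mem n y) (path_mem_component hα))
      (by rw [mul_assoc, path_mul_vertex hα])
      (fun h => hn (by rw [← hxα, h, zero_mul]))
    rw [Submodule.span_singleton_le_iff_mem]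
    have hzx : z * x = ghostPath K E a α := by
      rw [← hxα, ← mul_assoc, hz, vertex_mul_ghostPath hα]
    exact hzx ▸ mul_mem_of_gradedOperators J z hxJ

/-- By induction on the bound n: α* = ∑ e (α e)* over the finitely many edges e at c, and the bound
at r(e) is smaller by one. If c is a sink, there is nothing to expand, but c is unbranched. -/
theorem ghostPath_mem_sSup_isAtom (hE : E.RowFinite) (n : ℕ) {a c : V} {α : List A}
    (hα : E.IsPath a α c)
    (hc : ∀ (p : List A) (b : V), E.IsPath c p b → n ≤ p.length → E.Unbranched b) :
    ghostPath K E a α ∈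
      sSup {J : Submodule (gradedOperators K E) (LeavittPathAlgebra K E) | IsAtom J} := by
  induction n generalizing c α with
  | zero =>
    exact (le_sSup (isAtom_span_ghostPath hα (hc [] c (.nil c) le_rfl)) :
      Submodule.span _ _ ≤ _) (Submodule.mem_span_singleton_self _)
  | succ n ih =>
    by_cases hne : {e | E.src e = c}.Nonempty
    · rw [← vertex_mul_ghostPath hα, isLeavittFamily.ck2 c (hE c) hne, Finset.sum_mul]
      refine sum_mem fun e he => ?_
      obtain rfl : E.src e = c := by simpa using he
      have hαe := hα.append (.cons e (.nil _))
      rw [mul_assoc, ← ghostPath_singleton e (E.src e),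
        ghostPath_mul_ghostPath hα (.cons e (.nil _))]
      exact mul_mem_of_gradedOperators _ _
        (ih hαe fun p b hp hl => hc (e :: p) b (.cons e hp) (by simpa using hl))
    · have hub : E.Unbranched c := by
        rintro b ⟨p, hp⟩
        cases hp with
        | nil =>
          rintro ⟨e, -, -, he, -⟩
          exact hne ⟨e, he⟩
        | cons e _ => exact absurd ⟨e, rfl⟩ hne
      exact (le_sSup (isAtom_span_ghostPath hα hub) :
        Submodule.span _ _ ≤ _) (Submodule.mem_span_singleton_self _)

theorem isGradedSemisimpleRing_of_unbranched (hE : E.RowFinite)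
    (h : ∀ a : V, ∃ n : ℕ, ∀ (p : List A) (b : V), E.IsPath a p b → n ≤ p.length →
      E.Unbranched b) : IsGradedSemisimpleRing (grading K E) := by
  rw [isGradedSemisimpleRing_iff, eq_top_iff]
  rintro x -
  refine induction_mul_vertex (zero_mem _) (fun x y hx hy => add_mem hx hy) (fun y a => ?_) x
  obtain ⟨n, hn⟩ := h a
  exact mul_mem_of_gradedOperators _ _ (ghostPath_mem_sSup_isAtom hE n (.nil a) hn)

/-! ### Graded-simple modules over a graded semisimple algebra -/

variable {M : Type*} [AddCommGroup M] [Module (Unitization ℤ (LeavittPathAlgebra K E)) M]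
  {ℳ : ℤ → AddSubgroup M}

theorem unitization_add_smul {R : Type*} [NonUnitalRing R] {M : Type*} [AddCommGroup M]
    [Module (Unitization ℤ R) M] (s t : Unitization ℤ R) (x : M) : (s + t) • x = s • x + t • x :=
  (LinearMap.toSpanSingleton (Unitization ℤ R) M x).map_add s t

theorem unitization_smul_add {R : Type*} [NonUnitalRing R] {M : Type*} [AddCommGroup M]
    [Module (Unitization ℤ R) M] (t : Unitization ℤ R) (x y : M) : t • (x + y) = t • x + t • y :=
  Module.toDistribMulAction.smul_add t x y

theorem inr_mul_smul (a b : LeavittPathAlgebra K E) (x : M) :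
    ((a * b : LeavittPathAlgebra K E) : Unitization ℤ (LeavittPathAlgebra K E)) • x =
      (a : Unitization ℤ (LeavittPathAlgebra K E)) •
        (b : Unitization ℤ (LeavittPathAlgebra K E)) • x := by
  rw [Unitization.inr_mul, unitization_mul_smul]

theorem inr_add_smul (a b : LeavittPathAlgebra K E) (x : M) :
    ((a + b : LeavittPathAlgebra K E) : Unitization ℤ (LeavittPathAlgebra K E)) • x =
      (a : Unitization ℤ (LeavittPathAlgebra K E)) • x +
        (b : Unitization ℤ (LeavittPathAlgebra K E)) • x := by
  rw [Unitization.inr_add, unitization_add_smul]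

/-- The map `a ↦ a x`. -/
noncomputable def smulRight (x : M) : LeavittPathAlgebra K E →+ M where
  toFun a := (a : Unitization ℤ (LeavittPathAlgebra K E)) • x
  map_zero' := by rw [Unitization.inr_zero, zero_smul]
  map_add' a b := inr_add_smul a b x

/-- L is the sum of the L v, so if all vertices killed the homogeneous elements, L M would be 0,
against L M = M ≠ 0. -/
theorem _root_.IsGradedSimple.exists_vertex_smul (hM : IsGradedSimple (grading K E) ℳ) :
    ∃ (a : V) (n : ℤ) (x : M), x ∈ ℳ n ∧ x ≠ 0 ∧
      (vertex K E a : Unitization ℤ (LeavittPathAlgebra K E)) • x = x := by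
  by_contra! h
  have h0 : ∀ (a : V) (n : ℤ) (x : M), x ∈ ℳ n →
      (vertex K E a : Unitization ℤ (LeavittPathAlgebra K E)) • x = 0 := by
    intro a n x hx
    by_contra hne
    refine h a (0 + n) _ (hM.isGraded.smul_mem 0 n _ x (vertex_mem_component a) hx) hne ?_
    rw [← inr_mul_smul, vertex_mul_self]
  have h1 : ∀ (a : LeavittPathAlgebra K E) (x : M),
      (a : Unitization ℤ (LeavittPathAlgebra K E)) • x = 0 := by
    intro a x
    obtain ⟨z, rfl⟩ := hM.isGraded.isInternal.surjective x
    induction z using DirectSum.induction_on with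
    | zero => rw [map_zero, smul_zero]
    | of n x =>
      obtain ⟨x, hx⟩ := x
      rw [DirectSum.coeAddMonoidHom_of]
      refine induction_mul_vertex (P := fun a => smulRight x a = 0) (map_zero _)
        (fun a b ha hb => by rw [map_add, ha, hb, add_zero]) (fun y b => ?_) a
      change ((y * vertex K E b : LeavittPathAlgebra K E) :
        Unitization ℤ (LeavittPathAlgebra K E)) • x = 0
      rw [inr_mul_smul, h0 b n x hx, smul_zero]
    | add x y hx hy => rw [map_add, unitization_smul_add, hx, hy, add_zero]
  have := hM.nontrivial
  obtain ⟨x, hx⟩ := exists_ne (0 : M)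
  refine hx ?_
  have hcl : x ∈ (⊥ : AddSubgroup M) := by
    refine (AddSubgroup.closure_le _).2 ?_ (show x ∈ AddSubgroup.closure _ by
      rw [hM.isUnital]; exact AddSubgroup.mem_top x)
    rintro _ ⟨a, y, rfl⟩
    exact h1 a y
  exact hcl

/-- The annihilator in L of a homogeneous element is graded, because the components of y send x into
different degrees. -/
theorem _root_.IsGradedModule.proj_smul_eq_zero (hM : IsGradedModule (grading K E) ℳ) {n : ℤ}
    {x : M} (hx : x ∈ ℳ n) {y : LeavittPathAlgebra K E}
    (hy : (y : Unitization ℤ (LeavittPathAlgebra K E)) • x = 0) (m : ℤ) :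
    (proj K E m y : Unitization ℤ (LeavittPathAlgebra K E)) • x = 0 := by
  classical
  obtain ⟨s, f, hf, rfl⟩ := exists_eq_sum y
  have hf' : ∀ i, smulRight x (f i) ∈ ℳ (i + n) := fun i => hM.smul_mem i n _ x (hf i) hx
  rw [proj_sum s hf]
  split_ifs with hm
  · let z : DirectSum ℤ fun i => ℳ i :=
      ∑ i ∈ s, DirectSum.of (fun i => ℳ i) (i + n) ⟨_, hf' i⟩
    have hz : z = 0 := by
      refine hM.isInternal.injective ?_
      rw [map_zero, map_sum]
      simp only [DirectSum.coeAddMonoidHom_of]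
      rw [← map_sum]
      exact hy
    have h1 : z (m + n) = ⟨_, hf' m⟩ := by
      rw [DFinsupp.finsetSum_apply, Finset.sum_eq_single_of_mem m hm]
      · exact DirectSum.of_eq_same _ _
      · intro i _ hi
        exact DirectSum.of_eq_of_ne _ _ _ (by omega)
    rw [hz] at h1
    exact (congrArg Subtype.val h1).symm
  · rw [Unitization.inr_zero, zero_smul]

/-- Since v x = x, each t x equals (t v) x with t v in L, so the submodule generated by x is a sum
of homogeneous pieces; it is nonzero and hence everything. -/
theorem _root_.IsGradedSimple.surjective_toSpanSingleton (hM : IsGradedSimple (grading K E) ℳ)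
    {a : V} {n : ℤ} {x : M} (hx : x ∈ ℳ n) (h0 : x ≠ 0)
    (ha : (vertex K E a : Unitization ℤ (LeavittPathAlgebra K E)) • x = x) :
    Function.Surjective
      (LinearMap.toSpanSingleton (Unitization ℤ (LeavittPathAlgebra K E)) M x) := by
  rw [← LinearMap.range_eq_top]
  refine (hM.eq_bot_or_eq_top _ ?_).resolve_left fun h => h0 ?_
  · rintro _ ⟨t, rfl⟩
    have ht : t • x = smulRight x (t • vertex K E a) := by
      change t • x = ((t • vertex K E a : LeavittPathAlgebra K E) :
        Unitization ℤ (LeavittPathAlgebra K E)) • x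
      rw [unitization_smul_inr, unitization_mul_smul, ha]
    obtain ⟨s, hs⟩ := exists_eq_sum_proj (t • vertex K E a)
    rw [LinearMap.toSpanSingleton_apply, ht, hs, map_sum]
    exact sum_mem fun m _ => AddSubgroup.subset_closure
      ⟨⟨_, rfl⟩, m + n, hM.isGraded.smul_mem m n _ x (proj_mem m _) hx⟩
  · have : x ∈ LinearMap.range
        (LinearMap.toSpanSingleton (Unitization ℤ (LeavittPathAlgebra K E)) M x) :=
      ⟨1, LinearMap.toSpanSingleton_apply_one _ _ _⟩
    rw [h] at this
    exact this

/-- Graded-simple modules over a graded semisimple Leavitt path algebra are finitely presented. -/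
theorem finitePresentation_of_isGradedSemisimpleRing (hL : IsGradedSemisimpleRing (grading K E))
    (hM : IsGradedSimple (grading K E) ℳ) :
    Module.FinitePresentation (Unitization ℤ (LeavittPathAlgebra K E)) M := by
  obtain ⟨a, n, x, hx, h0, ha⟩ := hM.exists_vertex_smul
  have hsurj := hM.surjective_toSpanSingleton hx h0 ha
  have := complementedLattice_of_sSup_atoms_eq_top (isGradedSemisimpleRing_iff.1 hL)
  let N : Submodule (gradedOperators K E) (LeavittPathAlgebra K E) :=
    gradedSubmodule (smulRight x).ker
      (fun b y (hy : _ = _) => by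
        change ((b * y : LeavittPathAlgebra K E) :
          Unitization ℤ (LeavittPathAlgebra K E)) • x = 0
        rw [inr_mul_smul]
        exact (congrArg _ hy).trans (smul_zero _))
      (fun m y hy => hM.isGraded.proj_smul_eq_zero hx hy m)
  have hNmem : ∀ y : LeavittPathAlgebra K E,
      (y : Unitization ℤ (LeavittPathAlgebra K E)) • x = 0 ↔ y ∈ N := fun y => Iff.rfl
  obtain ⟨N', hN'⟩ := exists_isCompl N
  obtain ⟨p, hp, q, hq, hpq⟩ := Submodule.mem_sup.1
    (hN'.sup_eq_top ▸ Submodule.mem_top : vertex K E a ∈ N ⊔ N')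
  -- For y in N with y v = y and v = p + q, the element y q = y − y p lies in both N and its
  -- complement, so it vanishes.
  have key : ∀ y ∈ N, y * vertex K E a = y → y = y * p := by
    intro y hy hya
    rw [← hpq, mul_add] at hya
    have h1 : y * q ∈ N := by
      have h2 : y * q = y - y * p := (sub_eq_of_eq_add' hya.symm).symm
      rw [h2]
      exact sub_mem hy (mul_mem_of_gradedOperators N y hp)
    have h3 := Submodule.disjoint_def.1 hN'.disjoint _ h1 (mul_mem_of_gradedOperators N' y hq)
    rw [h3, add_zero] at hya
    exact hya.symm
  refine @Module.finitePresentation_of_surjective (Unitization ℤ (LeavittPathAlgebra K E))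
    (Unitization ℤ (LeavittPathAlgebra K E)) M _ Ring.toAddCommGroup _ _ _ inferInstance
    (LinearMap.toSpanSingleton (Unitization ℤ (LeavittPathAlgebra K E)) M x) hsurj ?_
  classical
  -- These generate because t = t (1 − v) + t v, and if t kills x then t v lies in N, so t v = (t v)
  -- p.
  refine ⟨{1 + ((-vertex K E a : LeavittPathAlgebra K E) :
    Unitization ℤ (LeavittPathAlgebra K E)), (p : Unitization ℤ (LeavittPathAlgebra K E))}, ?_⟩
  refine le_antisymm (Submodule.span_le.2 ?_) fun t (ht : t • x = 0) => ?_
  · intro t ht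
    simp only [Finset.coe_insert, Finset.coe_singleton, Set.mem_insert_iff,
      Set.mem_singleton_iff] at ht
    rcases ht with rfl | rfl
    · change (1 + ((-vertex K E a : LeavittPathAlgebra K E) :
        Unitization ℤ (LeavittPathAlgebra K E))) • x = 0
      have h1 : ((-vertex K E a : LeavittPathAlgebra K E) :
          Unitization ℤ (LeavittPathAlgebra K E)) • x = -x :=
        (map_neg (smulRight x) _).trans (congrArg _ ha)
      have h2 : (1 : Unitization ℤ (LeavittPathAlgebra K E)) • x = x :=
        LinearMap.toSpanSingleton_apply_one _ _ _
      rw [unitization_add_smul, h1, h2, add_neg_cancel]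
    · exact (hNmem p).2 hp
  · have hy : t • vertex K E a ∈ N := by
      rw [← hNmem, unitization_smul_inr, unitization_mul_smul, ha, ht]
    have hyp := key _ hy (by rw [← unitization_smul_mul, vertex_mul_self])
    have ht' : t = t * (1 + ((-vertex K E a : LeavittPathAlgebra K E) :
        Unitization ℤ (LeavittPathAlgebra K E))) +
        ((t • vertex K E a : LeavittPathAlgebra K E) :
          Unitization ℤ (LeavittPathAlgebra K E)) * (p : Unitization ℤ _) := by
      rw [← Unitization.inr_mul, ← hyp, unitization_smul_inr, Unitization.inr_neg, mul_add,
        mul_one, mul_neg, neg_add_cancel_right]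
    rw [ht']
    exact Submodule.add_mem _
      (Submodule.smul_mem _ t (Submodule.subset_span (by simp)))
      (Submodule.smul_mem _ ((t • vertex K E a : LeavittPathAlgebra K E) :
          Unitization ℤ (LeavittPathAlgebra K E))
        (Submodule.subset_span (by simp)))

end LeavittPathAlgebra

end

/-! ### The theorem. -/

theorem mainTheorem5 {V : Type u} {A : Type v} (E : DirectedGraph V A) (K : Type w) [Field K] :
    List.TFAE [
      ∀ (M : Type (max u v w)) [AddCommGroup M]
        [Module (Unitization ℤ (LeavittPathAlgebra K E)) M] (ℳ : ℤ → AddSubgroup M),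
        IsGradedSimple (LeavittPathAlgebra.grading K E) ℳ →
          Module.FinitePresentation (Unitization ℤ (LeavittPathAlgebra K E)) M,
      IsGradedSemisimpleRing (LeavittPathAlgebra.grading K E),
      E.RowFinite ∧ ∀ a : V, ∃ n : ℕ, ∀ (p : List A) (b : V), E.IsPath a p b → n ≤ p.length →
        E.IsLinePoint b ∨ E.IsLaurentVertex b] := by
  simp only [← DirectedGraph.unbranched_iff]
  tfae_have 1 → 3 := fun h => DirectedGraph.rowFinite_and_unbranched_of_finitePresentation h
  tfae_have 3 → 2 := fun h =>
    LeavittPathAlgebra.isGradedSemisimpleRing_of_unbranched h.1 h.2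
  tfae_have 2 → 1 := fun hL M _ _ _ hM =>
    LeavittPathAlgebra.finitePresentation_of_isGradedSemisimpleRing hL hM
  tfae_finish
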